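/- Let $n\ge 5$, and consider a register of qubits with all-to-all connectivity (CNOT and Toffoli gates may be applied to arbitrary distinct qubits), containing a set $C$ of $n$ control qubits, a target qubit $t\notin C$ and one further qubit $a\notin C\cup\{t\}$. The multi-controlled $X$ gate applies $X$ to $t$ on the basis states in which all qubits of $C$ are $1$, and the identity otherwise. A circuit is a sequence of time slots, each holding gates that act on pairwise disjoint sets of qubits; its cost in gates of a given type is the number of gates of that type, and its depth in that type is the number of time slots holding at least one such gate. (1) The multi-controlled $X$ gate can be implemented exactly with $a$ as a dirty ancilla (that is, as an identity of operators on the whole register, so that $a$ may be in an arbitrary state and is restored), by a single circuit that acts only on $C\cup\{t,a\}$ and uses only CNOT, $T$, $T^\dagger$ and $H$ gates (in particular, no arbitrary single-qubit rotations), in which - CNOT has cost $12(n+1)-32$ and depth $8(n+1)-8$, - $T$ (counting $T$ and $T^\dagger$ together) has cost $16(n+1)-48$ and depth $8(n+1)-6$ if $n+1$ is even, $8(n+1)-3$ if $n+1$ is odd, - $H$ has cost $8(n+1)-32+4$ and depth $4(n+1)-11$. (2) It can also be implemented exactly, with $a$ as a dirty ancilla, by a circuit that acts only on $C\cup\{t,a\}$,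 uses only Toffoli and $H$ gates, and has exactly $4n-8=4n+O(1)$ Toffoli gates. -/

import Mathlib

open scoped Matrix

noncomputable section

namespace MCX

variable {Q : Type*} [Fintype Q] [DecidableEq Q]

/-- Operators on the register whose qubits are labelled by `Q`, written in the computational basis:
a basis state assigns to every qubit a bit `0` or `1`. -/
abbrev Operator (Q : Type*) := Matrix (Q → Fin 2) (Q → Fin 2) ℂ

/-- The Pauli `X` operator. -/
def pauliX : Matrix (Fin 2) (Fin 2) ℂ := !![0, 1; 1, 0]

/-- The Hadamard operator. -/
def hadamard : Matrix (Fin 2) (Fin 2) ℂ := ((1 / Real.sqrt 2 : ℝ) : ℂ) • !![1, 1; 1, -1]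

/-- The phase operator `P(φ) = diag(1, e^{iφ})`. -/
def phase (φ : ℝ) : Matrix (Fin 2) (Fin 2) ℂ := !![1, 0; 0, Complex.exp (Complex.I * φ)]

/-- The single-qubit operator `U` acting on qubit `q`, tensored with the identity on all the
other qubits. -/
def onQubit (U : Matrix (Fin 2) (Fin 2) ℂ) (q : Q) : Operator Q :=
  Matrix.of fun x y => if ∀ p, p ≠ q → x p = y p then U (x q) (y q) else 0

/-- The operator `U` on qubit `t`, controlled by the set `C` of qubits: `U` is applied to `t` on the
basis states in which all qubits of `C` are `1`, and the identity on the others. -/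
def controlled (C : Finset Q) (t : Q) (U : Matrix (Fin 2) (Fin 2) ℂ) : Operator Q :=
  Matrix.of fun x y => if ∀ c ∈ C, y c = 1 then onQubit U t x y else (1 : Operator Q) x y

/-- The elementary gates, on an all-to-all connected register: multi-qubit gates may be applied
to arbitrary distinct qubits. -/
inductive Gate (Q : Type*) where
  /-- CNOT with control `c` and target `t`. -/
  | cnot (c t : Q) (h : c ≠ t)
  /-- The gate `T = P(π/4)`. -/
  | T (q : Q)
  /-- The inverse of the gate `T`. -/
  | Tdg (q : Q)
  /-- The Hadamard gate. -/
  | H (q : Q)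
  /-- The Toffoli gate with controls `c₁`, `c₂` and target `t`. -/
  | toffoli (c₁ c₂ t : Q) (h₁₂ : c₁ ≠ c₂) (h₁ : c₁ ≠ t) (h₂ : c₂ ≠ t)

/-- The types of gates that are counted; `T` and its inverse both count as `T` gates. -/
inductive GateType where
  | cnot
  | T
  | H
  | toffoli
  deriving DecidableEq

namespace Gate

/-- The type of a gate. -/
def type : Gate Q → GateType
  | cnot _ _ _ => .cnot
  | T _ => .T
  | Tdg _ => .T
  | H _ => .H
  | toffoli _ _ _ _ _ _ => .toffoli

/-- The set of qubits on which a gate acts. -/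
def support : Gate Q → Finset Q
  | cnot c t _ => {c, t}
  | T q => {q}
  | Tdg q => {q}
  | H q => {q}
  | toffoli c₁ c₂ t _ _ _ => {c₁, c₂, t}

/-- The operator that a gate applies to the register. -/
def operator : Gate Q → Operator Q
  | cnot c t _ => controlled {c} t pauliX
  | T q => onQubit (phase (Real.pi / 4)) q
  | Tdg q => onQubit (phase (-(Real.pi / 4))) q
  | H q => onQubit hadamard q
  | toffoli c₁ c₂ t _ _ _ => controlled {c₁, c₂} t pauliX

end Gate

/-- A circuit: a sequence of time slots, each of which holds gates acting on pairwise disjoint sets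
of qubits, so that they can be executed in parallel. -/
structure Circuit (Q : Type*) [DecidableEq Q] where
  /-- The time slots, in the order of execution. -/
  slots : List (List (Gate Q))
  /-- Gates in the same slot act on disjoint sets of qubits. -/
  parallel : ∀ s ∈ slots, s.Pairwise fun g h => Disjoint g.support h.support

namespace Circuit

/-- All the gates of a circuit, in the order of execution. -/
def gates (c : Circuit Q) : List (Gate Q) := c.slots.flatten

/-- The operator applied by a circuit; the gate that is executed first is the rightmost factor. -/
def operator (c : Circuit Q) : Operator Q := c.gates.foldl (fun M g => g.operator * M) 1

/-- The cost of a circuit in gates of type `k`: the number of these gates. -/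
def cost (c : Circuit Q) (k : GateType) : ℕ := c.gates.countP fun g => g.type = k

/-- The depth of a circuit in gates of type `k`: the number of time slots that hold such a gate. -/
def depth (c : Circuit Q) (k : GateType) : ℕ :=
  c.slots.countP fun s => s.any fun g => g.type = k

/-- The circuit acts only on qubits of the set `S`. -/
def ActsOn (c : Circuit Q) (S : Finset Q) : Prop := ∀ g ∈ c.gates, g.support ⊆ S

/-- Every gate of the circuit is of one of the types in `K`. -/
def UsesOnly (c : Circuit Q) (K : Set GateType) : Prop := ∀ g ∈ c.gates, g.type ∈ K

end Circuit

end MCX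

end

/-!
The target is conjugated by Hadamard gates, so that the sign `-1` on the states in which all of `C
∪ {t}` is `1` has to be implemented. Split `C ∪ {t}` into two sets of nearly equal size. If `V`
applies `Z` to `a` controlled by the first set and `W` applies `X` to `a` controlled by the second
one, then the commutator of `V` and `W` is this sign, because the commutator of `X` and `Z` is
`-1` (`commutator_eq_diagonal`, `controlled_pauliX_eq`). Here `V` and `W` only matter up to
phases: `V` may be any diagonal operator whose entries change sign with `a` when the first set is
all `1`, and `W` such an operator conjugated by a Hadamard gate on `a`; the surplus phases cancel
in the commutator.

Such a `V` with `r + 2` controls is a ladder: a doubly controlled `Z` gate on two controls and a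
qubit `d`, conjugated by a sequence of `r` Toffoli gates, each of which has a control and the
target of the previous gate as its controls; the first one is controlled by `a`, the last one has
the target `d`. The targets are taken from the second set and pick up phases only,
so that nothing has to be restored (`evalLayers_ladder`, `ladderPhase_flip`). Two pairs of ladders,
with `n + 1` controls in each pair, consist of `2 (2 (n + 1) - 6) = 4 n - 8` Toffoli gates.

Only the conjugation of diagonal operators matters, so that each Toffoli gate may be replaced by a
relative-phase version with three CNOT gates, four `T` gates and two Hadamard gates
(`relativePhase_conj_diagonal`). The gate at the bottom needs no Hadamard gates but one more CNOT.
Of the gates `T`, CNOT, `T†`, CNOT, `T`, CNOT, `T†` of a rung, only the one in the middle involves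
another rung. The first three of them are therefore executed in parallel for all rungs but the
first one; for the first rung they are executed in parallel with the end of the preceding ladder.
This gives a list of layers of equal gates (`commutatorLayers`) that has the required numbers of
gates and at most the required depths (`layerCost_commutator`, `layerDepth_commutator`,
`evalLayers_commutator`). Any depths between the numbers of layers and the numbers of gates can be
attained by distributing the gates of a layer over several time slots (`exists_circuit`).
-/

noncomputable section

namespace MCX

/-! ### Multiplexed operators and words of gates -/

variable {Q : Type*} [Fintype Q] [DecidableEq Q]

/-- The multiplexed single-qubit operator on `d`: on the basis states whose qubits other than `d`
are in state `y`, the operator `U y` is applied to `d`.  Only the values of `U` at states with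
`y d = 0` matter, so that `U` cannot depend on the qubit on which it acts. -/
def mux (d : Q) (U : (Q → Fin 2) → Matrix (Fin 2) (Fin 2) ℂ) : Operator Q :=
  Matrix.of fun x y =>
    if ∀ p, p ≠ d → x p = y p then U (Function.update y d 0) (x d) (y d) else 0

lemma mux_mul_apply (d : Q) (U : (Q → Fin 2) → Matrix (Fin 2) (Fin 2) ℂ) (M : Operator Q)
    (x y : Q → Fin 2) :
    (mux d U * M) x y =
      ∑ b, U (Function.update x d 0) (x d) b * M (Function.update x d b) y := by
  rw [Matrix.mul_apply]
  have hinj : Function.Injective fun b : Fin 2 => Function.update x d b := by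
    intro b b' h
    simpa using congrFun h d
  rw [← Finset.sum_subset (Finset.subset_univ (Finset.univ.image fun b => Function.update x d b))]
  · rw [Finset.sum_image fun b _ b' _ h => hinj h]
    refine Finset.sum_congr rfl fun b _ => ?_
    have : ∀ p, p ≠ d → x p = Function.update x d b p := fun p hp => by simp [hp]
    rw [mux, Matrix.of_apply, if_pos this, Function.update_idem, Function.update_self]
  · intro z _ hz
    have : ¬ ∀ p, p ≠ d → x p = z p := by
      intro h
      refine hz (Finset.mem_image.2 ⟨z d, Finset.mem_univ _, ?_⟩)
      funext p
      by_cases hp : p = d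
      · subst hp; simp
      · simp [hp, h p hp]
    simp [mux, this]

lemma mux_mul (d : Q) (U V : (Q → Fin 2) → Matrix (Fin 2) (Fin 2) ℂ) :
    mux d U * mux d V = mux d fun y => U y * V y := by
  ext x y
  rw [mux_mul_apply]
  by_cases h : ∀ p, p ≠ d → x p = y p
  · have hxy : Function.update x d 0 = Function.update y d 0 := by
      funext p
      by_cases hp : p = d
      · subst hp; simp
      · simp [hp, h p hp]
    have h' : ∀ b, ∀ p, p ≠ d → Function.update x d b p = y p := fun b p hp => by
      simp [hp, h p hp]
    simp only [mux, Matrix.of_apply, if_pos h, if_pos (h' _), Matrix.mul_apply, hxy,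
      Function.update_self]
  · have h' : ∀ b, ¬ ∀ p, p ≠ d → Function.update x d b p = y p := fun b hb =>
      h fun p hp => by simpa [hp] using hb p hp
    simp only [mux, Matrix.of_apply, h, h', if_false, mul_zero, Finset.sum_const_zero]

lemma mux_congr (d : Q) {U V : (Q → Fin 2) → Matrix (Fin 2) (Fin 2) ℂ}
    (h : ∀ y, U (Function.update y d 0) = V (Function.update y d 0)) : mux d U = mux d V := by
  ext x y
  simp [mux, h]

/-- Multiplexed operators on different qubits commute if neither is controlled by the qubit on
which the other one acts. -/
lemma mux_commute {d e : Q} (hde : d ≠ e) {U V : (Q → Fin 2) → Matrix (Fin 2) (Fin 2) ℂ}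
    (hU : ∀ y b, U (Function.update y e b) = U y) (hV : ∀ y b, V (Function.update y d b) = V y) :
    Commute (mux d U) (mux e V) := by
  have key : ∀ M : Operator Q, mux d U * (mux e V * M) = mux e V * (mux d U * M) := by
    intro M
    ext x y
    simp only [mux_mul_apply, Finset.mul_sum]
    rw [Finset.sum_comm]
    refine Finset.sum_congr rfl fun b _ => Finset.sum_congr rfl fun b' _ => ?_
    rw [Function.update_comm hde (b' : Fin 2) (0 : Fin 2) x, hV,
      Function.update_comm hde.symm (b : Fin 2) (0 : Fin 2) x, hU,
      Function.update_comm hde (b' : Fin 2) b x, Function.update_of_ne hde,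
      Function.update_of_ne hde.symm]
    ring
  simpa [Commute, SemiconjBy] using key 1

lemma onQubit_eq_mux (U : Matrix (Fin 2) (Fin 2) ℂ) (q : Q) : onQubit U q = mux q fun _ => U := rfl

lemma one_eq_mux (d : Q) : (1 : Operator Q) = mux d fun _ => 1 := by
  ext x y
  simp only [mux, Matrix.of_apply, Matrix.one_apply]
  by_cases h : x = y
  · simp [h]
  · rw [if_neg h]
    split_ifs with h1 h2
    · exact absurd (funext fun p => by
        by_cases hp : p = d
        · rw [hp, h2]
        · exact h1 p hp) h
    · rfl
    · rfl

lemma diagonal_eq_mux (f : (Q → Fin 2) → ℂ) (d : Q) :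
    (Matrix.diagonal f : Operator Q) =
      mux d fun y => Matrix.diagonal fun b => f (Function.update y d b) := by
  ext x y
  simp only [mux, Matrix.of_apply, Matrix.diagonal_apply, Function.update_idem]
  by_cases h : x = y
  · simp [h]
  · rw [if_neg h]
    split_ifs with h1 h2
    · exact absurd (funext fun p => by
        by_cases hp : p = d
        · rw [hp, h2]
        · exact h1 p hp) h
    · rfl
    · rfl

lemma controlled_eq_mux {C : Finset Q} {t : Q} (ht : t ∉ C) (U : Matrix (Fin 2) (Fin 2) ℂ) :
    controlled C t U = mux t fun y => if ∀ c ∈ C, y c = 1 then U else 1 := by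
  ext x y
  have h : (∀ c ∈ C, Function.update y t 0 c = 1) ↔ ∀ c ∈ C, y c = 1 :=
    forall₂_congr fun c hc => by rw [Function.update_of_ne (by rintro rfl; exact ht hc)]
  rw [controlled, Matrix.of_apply, one_eq_mux t, onQubit_eq_mux]
  simp only [mux, Matrix.of_apply, h]
  split_ifs <;> rfl

lemma Gate.exists_operator_eq_mux (g : Gate Q) :
    ∃ d ∈ g.support, ∃ U, g.operator = mux d U ∧
      ∀ e ∉ g.support, ∀ y b, U (Function.update y e b) = U y := by
  cases g with
  | cnot c t h =>
    refine ⟨t, by simp [Gate.support], _, controlled_eq_mux (by simpa using h.symm) _, ?_⟩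
    intro e he y b
    simp only [Gate.support, Finset.mem_insert, Finset.mem_singleton, not_or] at he
    simp [Function.update_of_ne (Ne.symm he.1)]
  | T q => exact ⟨q, by simp [Gate.support], _, onQubit_eq_mux _ _, fun _ _ _ _ => rfl⟩
  | Tdg q => exact ⟨q, by simp [Gate.support], _, onQubit_eq_mux _ _, fun _ _ _ _ => rfl⟩
  | H q => exact ⟨q, by simp [Gate.support], _, onQubit_eq_mux _ _, fun _ _ _ _ => rfl⟩
  | toffoli c₁ c₂ t h₁₂ h₁ h₂ =>
    refine ⟨t, by simp [Gate.support], _,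
      controlled_eq_mux (by simpa using ⟨h₁.symm, h₂.symm⟩) _, ?_⟩
    intro e he y b
    simp only [Gate.support, Finset.mem_insert, Finset.mem_singleton, not_or] at he
    simp [Function.update_of_ne (Ne.symm he.1), Function.update_of_ne (Ne.symm he.2.1)]

lemma Gate.commute_of_disjoint {g h : Gate Q} (H : Disjoint g.support h.support) :
    Commute g.operator h.operator := by
  obtain ⟨d, hd, U, hU, hU'⟩ := g.exists_operator_eq_mux
  obtain ⟨e, he, V, hV, hV'⟩ := h.exists_operator_eq_mux
  rw [hU, hV]
  exact mux_commute (by rintro rfl; exact Finset.disjoint_left.1 H hd he)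
    (hU' e (Finset.disjoint_right.1 H he)) (hV' d (Finset.disjoint_left.1 H hd))

/-- The operator applied by a word of gates, the first gate being executed first. -/
def evalWord : List (Gate Q) → Operator Q
  | [] => 1
  | g :: w => evalWord w * g.operator

lemma evalWord_append (u w : List (Gate Q)) : evalWord (u ++ w) = evalWord w * evalWord u := by
  induction u with
  | nil => simp [evalWord]
  | cons g u ih => simp [evalWord, ih, mul_assoc]

lemma Circuit.operator_eq_evalWord (c : Circuit Q) : c.operator = evalWord c.gates := by
  have key : ∀ (w : List (Gate Q)) (M : Operator Q),
      w.foldl (fun M g => g.operator * M) M = evalWord w * M := by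
    intro w
    induction w with
    | nil => simp [evalWord]
    | cons g w ih => intro M; simp [evalWord, ih, mul_assoc]
  simp [Circuit.operator, key]

/-- All gates of the word `w` act on qubits listed in `S` only. -/
def WordOn (w : List (Gate Q)) (S : List Q) : Prop := ∀ g ∈ w, ∀ q ∈ g.support, q ∈ S

lemma WordOn.commute {u w : List (Gate Q)} {S S' : List Q} (hu : WordOn u S) (hw : WordOn w S')
    (hS : S.Disjoint S') : Commute (evalWord u) (evalWord w) := by
  have key : ∀ g h, g ∈ u → h ∈ w → Commute g.operator h.operator := fun g h hg hh =>
    Gate.commute_of_disjoint (Finset.disjoint_left.2 fun q hq hq' =>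
      hS (hu g hg q hq) (hw h hh q hq'))
  have aux : ∀ g ∈ u, ∀ v, (∀ h ∈ v, h ∈ w) → Commute g.operator (evalWord v) := by
    intro g hg v
    induction v with
    | nil => intro _; exact Commute.one_right _
    | cons h v ih =>
      intro hv
      exact (ih fun k hk => hv k (List.mem_cons_of_mem _ hk)).mul_right
        (key g h hg (hv h List.mem_cons_self))
  clear key hu
  induction u with
  | nil => exact Commute.one_left _
  | cons g u ih =>
    exact (ih fun k hk => aux k (List.mem_cons_of_mem _ hk)).mul_left
      (aux g List.mem_cons_self w fun _ h => h)

end MCX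
end

noncomputable section

namespace MCX

/-! ### The phases of a ladder -/

section Phases

/-- The qubits of a ladder: the inner control of the first rung, the two controls at the bottom,
and the controls and targets of the rungs. -/
def ladderQubits {Q : Type*} (e₁ e₂ p : Q) (L : List (Q × Q)) : List Q :=
  p :: e₁ :: e₂ :: (L.map Prod.fst ++ L.map Prod.snd)

lemma ladderQubits_cons_nodup {Q : Type*} {e₁ e₂ p c d : Q} {L : List (Q × Q)}
    (h : (ladderQubits e₁ e₂ p ((c, d) :: L)).Nodup) : (ladderQubits e₁ e₂ d L).Nodup := by
  simp only [ladderQubits, List.map_cons, List.nodup_cons, List.cons_append, List.mem_cons,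
    List.mem_append, List.nodup_append, not_or, ne_eq] at h ⊢
  grind

variable {Q : Type*} [DecidableEq Q]

/-- The permutation of the basis states induced by the Toffoli gate with controls `c`, `p` and
target `d`. -/
def toffoliMap (c p d : Q) (y : Q → Fin 2) : Q → Fin 2 :=
  if y p = 1 ∧ y c = 1 then Function.update y d (y d + 1) else y

/-- The phase `ζ (-1)^{y p}` if the qubits `e₁` and `e₂` are both `1`, and no phase otherwise.
For `ζ = 1` this is the phase of the doubly controlled `Z` gate. -/
def basePhase (ζ : ℂ) (e₁ e₂ p : Q) (y : Q → Fin 2) : ℂ :=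
  if y e₁ = 1 ∧ y e₂ = 1 then (if y p = 1 then -ζ else ζ) else 1

/-- The phase obtained from `basePhase` by conjugating with a ladder of Toffoli gates. The pairs
`(c, d)` of the list are the outer control and the target of each rung; the inner control is the
target of the previous rung, and `p` for the first one. -/
def ladderPhase (ζ : ℂ) (e₁ e₂ : Q) : Q → List (Q × Q) → (Q → Fin 2) → ℂ
  | p, [] => basePhase ζ e₁ e₂ p
  | p, (c, d) :: L => fun y => ladderPhase ζ e₁ e₂ d L (toffoliMap c p d y)

lemma ladderPhase_mul_eq_one {ζ ξ : ℂ} (h : ζ * ξ = 1) (e₁ e₂ p : Q) (L : List (Q × Q))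
    (y : Q → Fin 2) : ladderPhase ζ e₁ e₂ p L y * ladderPhase ξ e₁ e₂ p L y = 1 := by
  induction L generalizing p y with
  | nil =>
    simp only [ladderPhase, basePhase]
    split_ifs <;> simp [h]
  | cons x L ih => exact ih _ _

lemma ladderPhase_update {ζ : ℂ} {e₁ e₂ p q : Q} {L : List (Q × Q)}
    (hq : q ∉ ladderQubits e₁ e₂ p L) (y : Q → Fin 2) (b : Fin 2) :
    ladderPhase ζ e₁ e₂ p L (Function.update y q b) = ladderPhase ζ e₁ e₂ p L y := by
  induction L generalizing p y with
  | nil =>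
    simp only [ladderQubits, List.map_nil, List.append_nil, List.mem_cons, not_or] at hq
    simp [ladderPhase, basePhase, Function.update_of_ne (Ne.symm hq.1),
      Function.update_of_ne (Ne.symm hq.2.1), Function.update_of_ne (Ne.symm hq.2.2.1)]
  | cons x L ih =>
    obtain ⟨c, d⟩ := x
    simp only [ladderQubits, List.map_cons, List.cons_append, List.mem_cons, List.mem_append,
      not_or] at hq
    have ih' := ih (p := d) (by
      simp only [ladderQubits, List.mem_cons, List.mem_append, not_or]; tauto)
    have hd : d ≠ q := by tauto
    simp only [ladderPhase, toffoliMap, Function.update_of_ne (Ne.symm hq.1),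
      Function.update_of_ne hd, Function.update_of_ne (show c ≠ q by tauto)]
    split_ifs
    · rw [Function.update_comm hd.symm, ih']
    · exact ih' y

/-- The phase of a ladder changes sign with the qubit `p` exactly when all the controls of the
ladder are `1`. -/
lemma ladderPhase_flip {ζ : ℂ} {e₁ e₂ p : Q} {L : List (Q × Q)}
    (h : (ladderQubits e₁ e₂ p L).Nodup) (y : Q → Fin 2) :
    ladderPhase ζ e₁ e₂ p L (Function.update y p 1) =
      ladderPhase ζ e₁ e₂ p L (Function.update y p 0) *
        if ∀ q ∈ e₁ :: e₂ :: L.map Prod.fst, y q = 1 then -1 else 1 := by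
  induction L generalizing p y with
  | nil =>
    simp only [ladderQubits, List.map_nil, List.append_nil, List.nodup_cons, List.mem_cons,
      not_or] at h
    simp only [ladderPhase, basePhase, Function.update_of_ne (Ne.symm h.1.1),
      Function.update_of_ne (Ne.symm h.1.2.1), Function.update_self]
    by_cases h1 : y e₁ = 1 <;> by_cases h2 : y e₂ = 1 <;> simp [h1, h2]
  | cons x L ih =>
    obtain ⟨c, d⟩ := x
    have h' := ladderQubits_cons_nodup h
    have hp : p ∉ ladderQubits e₁ e₂ d L := by
      simp only [ladderQubits, List.map_cons, List.nodup_cons, List.cons_append, List.mem_cons,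
        List.mem_append, not_or] at h ⊢
      tauto
    have hpd : d ≠ p := fun hh => hp (by simp [ladderQubits, hh])
    have hpc : c ≠ p := by
      rintro rfl
      simp [ladderQubits] at h
    have ihy := ih h' y
    have hup := fun z b => ladderPhase_update (ζ := ζ) hp z b
    simp only [ladderPhase, toffoliMap, Function.update_of_ne hpc, Function.update_self,
      Function.update_of_ne hpd, true_and, zero_ne_one, false_and, if_false]
    by_cases hc : y c = 1
    · have hiff : (∀ q ∈ e₁ :: e₂ :: List.map Prod.fst ((c, d) :: L), y q = 1) ↔
          ∀ q ∈ e₁ :: e₂ :: L.map Prod.fst, y q = 1 := by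
        simp [hc]
      simp only [hiff, if_pos hc]
      rw [Function.update_comm hpd.symm, hup, hup]
      rcases (show y d = 0 ∨ y d = 1 by omega) with hd | hd
      · have hy : Function.update y d 0 = y := by rw [← hd, Function.update_eq_self]
        rw [hd, zero_add, ihy, hy]
      · have hy : Function.update y d 1 = y := by rw [← hd, Function.update_eq_self]
        rw [hy] at ihy
        rw [hd, show (1 : Fin 2) + 1 = 0 from rfl, ihy]
        split_ifs <;> ring
    · have hiff : ¬ ∀ q ∈ e₁ :: e₂ :: List.map Prod.fst ((c, d) :: L), y q = 1 := by
        simp [hc]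
      rw [if_neg hc, if_neg hiff, mul_one, hup, hup]

end Phases

variable {Q : Type*} [Fintype Q] [DecidableEq Q]

/-- Conjugating a diagonal operator by the involution `R` permutes its entries as the Toffoli gate
with controls `c`, `p` and target `d` does. This holds for the Toffoli gate and also for its
versions up to relative phases. -/
def IsRung (c p d : Q) (R : Operator Q) : Prop :=
  ∀ f : (Q → Fin 2) → ℂ, R * Matrix.diagonal f * R = Matrix.diagonal fun y => f (toffoliMap c p d y)

lemma isRung_mux {c p d : Q} (hc : c ≠ d) (hp : p ≠ d)
    {W : (Q → Fin 2) → Matrix (Fin 2) (Fin 2) ℂ}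
    (hW : ∀ y v, W y * Matrix.diagonal v * W y =
      Matrix.diagonal fun b => if y p = 1 ∧ y c = 1 then v (b + 1) else v b) :
    IsRung c p d (mux d W) := by
  intro f
  rw [diagonal_eq_mux f d, mux_mul, mux_mul, diagonal_eq_mux _ d]
  refine mux_congr d fun y => ?_
  rw [hW]
  simp only [Function.update_idem, Function.update_of_ne hc, Function.update_of_ne hp, toffoliMap,
    Function.update_self]
  congr 1
  funext b
  split_ifs <;> rfl


/-! ### Products of single-qubit operators -/

lemma diagonal_fin_two (v : Fin 2 → ℂ) : Matrix.diagonal v = !![v 0, 0; 0, v 1] := by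
  ext i j
  fin_cases i <;> fin_cases j <;> simp

lemma hadamard_conj (α β γ δ : ℂ) :
    hadamard * !![α, β; γ, δ] * hadamard =
      !![(α + β + γ + δ) / 2, (α - β + γ - δ) / 2; (α + β - γ - δ) / 2, (α - β - γ + δ) / 2] := by
  have hs : ((1 / Real.sqrt 2 : ℝ) : ℂ) * ((1 / Real.sqrt 2 : ℝ) : ℂ) = 1 / 2 := by
    rw [← Complex.ofReal_mul, div_mul_div_comm, Real.mul_self_sqrt (by norm_num)]
    norm_num
  rw [hadamard, Matrix.smul_mul, Matrix.mul_smul, Matrix.smul_mul, smul_smul, hs]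
  ext i j
  fin_cases i <;> fin_cases j <;> simp <;> ring

lemma hadamard_mul_self : hadamard * hadamard = 1 := by
  have h := hadamard_conj 1 0 0 1
  rw [← Matrix.one_fin_two, mul_one] at h
  rw [h, Matrix.one_fin_two]
  norm_num

lemma exists_phase_eq : ∃ w w' : ℂ, w * w' = 1 ∧ w * w = Complex.I ∧ w' * w' = -Complex.I ∧
    phase (Real.pi / 4) = !![1, 0; 0, w] ∧ phase (-(Real.pi / 4)) = !![1, 0; 0, w'] := by
  refine ⟨Complex.exp (Complex.I * ((Real.pi / 4 : ℝ) : ℂ)),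
    Complex.exp (Complex.I * ((-(Real.pi / 4) : ℝ) : ℂ)), ?_, ?_, ?_, rfl, rfl⟩
  · rw [← Complex.exp_add]; simp
  · rw [← Complex.exp_add]
    refine Eq.trans (congrArg _ ?_) Complex.exp_pi_div_two_mul_I
    push_cast; ring
  · rw [← Complex.exp_add]
    refine Eq.trans (congrArg _ ?_) Complex.exp_neg_pi_div_two_mul_I
    push_cast; ring

/-- The operator that the word `T`, CNOT, `T†` applies to the target of the CNOT; `b` tells whether
the control is `1`. -/
def shiftedX (b : Prop) [Decidable b] : Matrix (Fin 2) (Fin 2) ℂ :=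
  phase (-(Real.pi / 4)) * (if b then pauliX else 1) * phase (Real.pi / 4)

lemma shiftedX_mul_self (b : Prop) [Decidable b] : shiftedX b * shiftedX b = 1 := by
  obtain ⟨w, w', h, -, -, h1, h2⟩ := exists_phase_eq
  have h' : w' * w = 1 := by rw [mul_comm, h]
  rw [shiftedX, h1, h2]
  split_ifs <;> simp [pauliX, Matrix.one_fin_two, h, h']

/-- The relative-phase Toffoli gate, as an operator on the target. If only the inner control is
`1`, it is `Z`, and if both controls are `1`, it is `Y` up to a sign. -/
lemma relativePhase_conj_diagonal (p c : Prop) [Decidable p] [Decidable c] (v : Fin 2 → ℂ) :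
    (hadamard * (shiftedX c * (if p then pauliX else 1) * shiftedX c) * hadamard) *
        Matrix.diagonal v *
        (hadamard * (shiftedX c * (if p then pauliX else 1) * shiftedX c) * hadamard) =
      Matrix.diagonal fun b => if p ∧ c then v (b + 1) else v b := by
  by_cases hp : p
  · obtain ⟨w, w', h, hw, hw', h1, h2⟩ := exists_phase_eq
    by_cases hc : c
    · have : shiftedX c * (if p then pauliX else 1) * shiftedX c =
          !![0, -Complex.I; Complex.I, 0] ∨
          shiftedX c * (if p then pauliX else 1) * shiftedX c =
          !![0, Complex.I; -Complex.I, 0] := by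
        simp [shiftedX, h1, h2, hp, hc, pauliX, hw, hw']
      rcases this with h | h <;> rw [h, hadamard_conj, diagonal_fin_two, diagonal_fin_two] <;>
        simp [hp, hc] <;> ring_nf <;> simp
    · have : shiftedX c * (if p then pauliX else 1) * shiftedX c = !![0, 1; 1, 0] := by
        have h' : w' * w = 1 := by rw [mul_comm, h]
        simp [shiftedX, h1, h2, hp, hc, pauliX, h']
      rw [this, hadamard_conj, diagonal_fin_two, diagonal_fin_two]
      simp [hp, hc]
      ring
  · simp only [hp, if_false, mul_one, shiftedX_mul_self, false_and, hadamard_mul_self, one_mul]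

lemma toffoli_conj_diagonal (p c : Prop) [Decidable p] [Decidable c] (v : Fin 2 → ℂ) :
    (if p ∧ c then pauliX else 1) * Matrix.diagonal v * (if p ∧ c then pauliX else 1) =
      Matrix.diagonal fun b => if p ∧ c then v (b + 1) else v b := by
  by_cases h : p ∧ c
  · simp only [if_pos h, diagonal_fin_two]
    simp [pauliX]
  · simp only [if_neg h, mul_one, one_mul]

/-- The commutator of `X` and `Z` is `-1`; here either of them may be absent, and their relative
phases `f`, `g` cancel. -/
lemma commutator_fin_two (α β : Prop) [Decidable α] [Decidable β] (f f' g g' : Fin 2 → ℂ)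
    (hf : ∀ i, f i * f' i = 1) (hg : ∀ i, g i * g' i = 1)
    (hfα : f 1 = f 0 * if α then -1 else 1) (hgβ : g 1 = g 0 * if β then -1 else 1) :
    hadamard * Matrix.diagonal g' * hadamard * Matrix.diagonal f' *
        (hadamard * Matrix.diagonal g * hadamard) * Matrix.diagonal f =
      Matrix.diagonal fun _ => if α ∧ β then -1 else 1 := by
  have hf0 := hf 0
  have hf1 := hf 1
  have hg0 := hg 0
  have hg1 := hg 1
  have hf0' : f 0 ≠ 0 := left_ne_zero_of_mul_eq_one hf0
  have hg0' : g 0 ≠ 0 := left_ne_zero_of_mul_eq_one hg0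
  have ef0 : f' 0 = (f 0)⁻¹ := eq_inv_of_mul_eq_one_right hf0
  have ef1 : f' 1 = (f 1)⁻¹ := eq_inv_of_mul_eq_one_right hf1
  have eg0 : g' 0 = (g 0)⁻¹ := eq_inv_of_mul_eq_one_right hg0
  have eg1 : g' 1 = (g 1)⁻¹ := eq_inv_of_mul_eq_one_right hg1
  simp only [diagonal_fin_two, hadamard_conj, ef0, ef1, eg0, eg1, hfα, hgβ]
  by_cases ha : α <;> by_cases hb : β <;> simp [ha, hb] <;> field_simp

lemma hadamard_conj_sign (b : Prop) [Decidable b] :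
    hadamard * Matrix.diagonal (fun i => if b ∧ i = 1 then -1 else 1) * hadamard =
      if b then pauliX else 1 := by
  by_cases hb : b <;> simp [diagonal_fin_two, hadamard_conj, hb, pauliX, Matrix.one_fin_two]

/-- The relative-phase Toffoli gate without its Hadamard gates, followed by one more CNOT, is a
doubly controlled `Z` gate up to a phase of the controls. -/
lemma bottom_fin_two (c₁ c₂ : Prop) [Decidable c₁] [Decidable c₂] :
    (if c₁ then pauliX else 1) * phase (-(Real.pi / 4)) * (if c₂ then pauliX else 1) *
        phase (Real.pi / 4) * (if c₁ then pauliX else 1) * phase (-(Real.pi / 4)) *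
        (if c₂ then pauliX else 1) * phase (Real.pi / 4) =
      Matrix.diagonal fun b =>
        if c₁ ∧ c₂ then (if b = 1 then -(-Complex.I) else -Complex.I) else 1 := by
  obtain ⟨w, w', h, hw, hw', h1, h2⟩ := exists_phase_eq
  have h' : w' * w = 1 := by rw [mul_comm, h]
  rw [h1, h2, diagonal_fin_two]
  by_cases hc : c₁ <;> by_cases hd : c₂ <;>
    simp [hc, hd, pauliX, Matrix.one_fin_two, hw, hw', h, h']

lemma bottom_inv_fin_two (c₁ c₂ : Prop) [Decidable c₁] [Decidable c₂] :
    (if c₁ then pauliX else 1) * phase (Real.pi / 4) * (if c₂ then pauliX else 1) *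
        phase (-(Real.pi / 4)) * (if c₁ then pauliX else 1) * phase (Real.pi / 4) *
        (if c₂ then pauliX else 1) * phase (-(Real.pi / 4)) =
      Matrix.diagonal fun b =>
        if c₁ ∧ c₂ then (if b = 1 then -Complex.I else Complex.I) else 1 := by
  obtain ⟨w, w', h, hw, hw', h1, h2⟩ := exists_phase_eq
  have h' : w' * w = 1 := by rw [mul_comm, h]
  rw [h1, h2, diagonal_fin_two]
  by_cases hc : c₁ <;> by_cases hd : c₂ <;>
    simp [hc, hd, pauliX, Matrix.one_fin_two, hw, hw', h, h']


/-! ### From the commutator to the multi-controlled gate -/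

/-- Let `F` change sign with `a` exactly when the qubits in `S` are all `1`, and `G` likewise for
`S'`. The commutator of `diag F` and of `diag G` conjugated by a Hadamard gate on `a` is the sign
controlled by `S` and `S'`. -/
lemma commutator_eq_diagonal {a : Q} {S S' : List Q} (hS : a ∉ S) (hS' : a ∉ S')
    {F F' G G' : (Q → Fin 2) → ℂ} (hF : ∀ y, F y * F' y = 1) (hG : ∀ y, G y * G' y = 1)
    (hFS : ∀ y, F (Function.update y a 1) =
      F (Function.update y a 0) * if ∀ q ∈ S, y q = 1 then -1 else 1)
    (hGS : ∀ y, G (Function.update y a 1) =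
      G (Function.update y a 0) * if ∀ q ∈ S', y q = 1 then -1 else 1) :
    onQubit hadamard a * Matrix.diagonal G' * onQubit hadamard a * Matrix.diagonal F' *
        (onQubit hadamard a * Matrix.diagonal G * onQubit hadamard a) * Matrix.diagonal F =
      (Matrix.diagonal fun y => if (∀ q ∈ S, y q = 1) ∧ ∀ q ∈ S', y q = 1 then -1 else 1 :
        Operator Q) := by
  have hu : ∀ {S : List Q}, a ∉ S → ∀ (y : Q → Fin 2) (b : Fin 2),
      (∀ q ∈ S, Function.update y a b q = 1) ↔ ∀ q ∈ S, y q = 1 := fun hS y b =>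
    forall₂_congr fun q hq => by rw [Function.update_of_ne (by rintro rfl; exact hS hq)]
  simp only [onQubit_eq_mux, diagonal_eq_mux _ a, mux_mul]
  refine mux_congr a fun y => ?_
  rw [commutator_fin_two (∀ q ∈ S, y q = 1) (∀ q ∈ S', y q = 1)]
  · simp only [Function.update_idem, hu hS, hu hS']
  · exact fun i => hF _
  · exact fun i => hG _
  · simpa only [Function.update_idem] using hFS y
  · simpa only [Function.update_idem] using hGS y

lemma controlled_pauliX_eq {C : Finset Q} {t : Q} (ht : t ∉ C) {σ : (Q → Fin 2) → Prop}
    [DecidablePred σ] (hσ : ∀ y, σ y ↔ (∀ q ∈ C, y q = 1) ∧ y t = 1) :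
    onQubit hadamard t * (Matrix.diagonal fun y => if σ y then -1 else 1 : Operator Q) *
        onQubit hadamard t =
      controlled C t pauliX := by
  have hu : ∀ (y : Q → Fin 2) (b : Fin 2),
      (∀ q ∈ C, Function.update y t b q = 1) ↔ ∀ q ∈ C, y q = 1 := fun y b =>
    forall₂_congr fun q hq => by rw [Function.update_of_ne (by rintro rfl; exact ht hq)]
  rw [controlled_eq_mux ht, diagonal_eq_mux _ t, onQubit_eq_mux, mux_mul, mux_mul]
  refine mux_congr t fun y => ?_
  simp only [hσ, hu, Function.update_self, hadamard_conj_sign]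

end MCX
end

noncomputable section

namespace MCX

/-! ### Layers and their serialization -/

/-- A layer is a set of gates of one type that are to be executed in parallel, together with this
type. -/
abbrev Layer (Q : Type*) := GateType × List (Gate Q)

section Serialization

variable {Q : Type*}

/-- The word of all gates of a list of layers. -/
def layerWord (ls : List (Layer Q)) : List (Gate Q) := ls.flatMap Prod.snd

/-- The number of layers of type `k`. -/
def layerDepth (ls : List (Layer Q)) (k : GateType) : ℕ := (ls.map Prod.fst).count k

/-- The number of gates in the layers of type `k`. -/
def layerCost (ls : List (Layer Q)) (k : GateType) : ℕ :=
  (ls.map fun l => if l.1 = k then l.2.length else 0).sum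

variable [DecidableEq Q]

/-- The layer consists of gates of its type, which is in `K`, on qubits in `S`, and they can be
executed in parallel. -/
def IsLayer (K : Set GateType) (S : Finset Q) (l : Layer Q) : Prop :=
  l.1 ∈ K ∧ (∀ g ∈ l.2, g.type = l.1 ∧ g.support ⊆ S) ∧
    l.2.Pairwise fun g h => Disjoint g.support h.support

omit [DecidableEq Q] in
lemma countP_layerWord {ls : List (Layer Q)} (h : ∀ l ∈ ls, ∀ g ∈ l.2, g.type = l.1)
    (k : GateType) : (layerWord ls).countP (fun g => g.type = k) = layerCost ls k := by
  induction ls with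
  | nil => rfl
  | cons l ls ih =>
    have ih := ih fun l' hl' => h l' (List.mem_cons_of_mem _ hl')
    have hl := h l List.mem_cons_self
    simp only [layerWord, layerCost, List.flatMap_cons, List.countP_append, List.map_cons,
      List.sum_cons] at ih ⊢
    rw [ih]
    congr 1
    split_ifs with hk
    · exact List.countP_eq_length.2 fun g hg => by simpa using (hl g hg).trans hk
    · exact List.countP_eq_zero.2 fun g hg => by simpa [hl g hg] using hk

/-- A layer can be spread over any number `x` of slots up to its number of gates, with `0 < x`
unless the layer is empty. -/
lemma exists_slots_of_layer {l : Layer Q} {x : ℕ} (hl : ∀ g ∈ l.2, g.type = l.1)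
    (hp : l.2.Pairwise fun g h => Disjoint g.support h.support) (hx : x ≤ l.2.length)
    (hx' : x = 0 → l.2 = []) :
    ∃ slots : List (List (Gate Q)), slots.flatten = l.2 ∧
      (∀ s ∈ slots, s.Pairwise fun g h => Disjoint g.support h.support) ∧
      ∀ k, (slots.countP fun s => s.any fun g => g.type = k) = if l.1 = k then x else 0 := by
  obtain ⟨τ, w⟩ := l
  simp only at hl hp hx hx' ⊢
  induction w generalizing x with
  | nil =>
    obtain rfl : x = 0 := by simpa using hx
    exact ⟨[], by simp⟩
  | cons g w ih =>
    obtain ⟨hg, hw⟩ := List.forall_mem_cons.1 hl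
    rcases (show x = 0 ∨ x = 1 ∨ 2 ≤ x by omega) with rfl | rfl | hx2
    · simp at hx'
    · refine ⟨[g :: w], by simp, by simpa using hp, fun k => ?_⟩
      by_cases hk : τ = k
      · simp [hg, hk]
      · have : ∀ g ∈ w, ¬ g.type = k := fun g' hg' => by rwa [hw g' hg']
        simp [hg, hk, List.countP_cons]
        exact this
    · obtain ⟨slots, h1, h2, h3⟩ := ih (x := x - 1) hw (List.pairwise_cons.1 hp).2
        (by simp at hx; omega) (by omega)
      refine ⟨[g] :: slots, by simp [h1], by simpa using h2, fun k => ?_⟩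
      rw [List.countP_cons, h3]
      by_cases hk : τ = k
      · simp [hg, hk]; omega
      · simp [hg, hk]

/-- A list of layers can be executed in slots with any prescribed depths between the numbers of
layers and the numbers of gates, without changing the order of the gates. The minimum in the lower
bound accounts for empty layers, which need no slot. -/
lemma exists_slots (ls : List (Layer Q)) (h : ∀ l ∈ ls, (∀ g ∈ l.2, g.type = l.1) ∧
      l.2.Pairwise fun g h => Disjoint g.support h.support) (D : GateType → ℕ)
    (h₁ : ∀ k, min (layerDepth ls k) (layerCost ls k) ≤ D k) (h₂ : ∀ k, D k ≤ layerCost ls k) :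
    ∃ slots : List (List (Gate Q)), slots.flatten = layerWord ls ∧
      (∀ s ∈ slots, s.Pairwise fun g h => Disjoint g.support h.support) ∧
      ∀ k, (slots.countP fun s => s.any fun g => g.type = k) = D k := by
  induction ls generalizing D with
  | nil => exact ⟨[], by simpa [layerWord, layerCost, eq_comm] using h₂⟩
  | cons l ls ih =>
    obtain ⟨⟨hl, hp⟩, hls⟩ := List.forall_mem_cons.1 h
    -- the first layer gets as many slots as the later ones allow
    obtain ⟨x, hx⟩ : ∃ x, x = min l.2.length (D l.1 - min (layerDepth ls l.1) (layerCost ls l.1)) :=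
      ⟨_, rfl⟩
    have e₁ : ∀ k, layerDepth (l :: ls) k = layerDepth ls k + if l.1 = k then 1 else 0 := by
      intro k; simp [layerDepth, List.count_cons]
    have e₂ : ∀ k, layerCost (l :: ls) k =
        (if l.1 = k then l.2.length else 0) + layerCost ls k := by
      intro k; simp [layerCost]
    have hl₁ := h₁ l.1
    have hl₂ := h₂ l.1
    rw [e₁, e₂, if_pos rfl, if_pos rfl] at hl₁
    rw [e₂, if_pos rfl] at hl₂
    obtain ⟨s₁, a₁, a₂, a₃⟩ := exists_slots_of_layer (x := x) hl hp (by omega)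
      (fun h0 => List.length_eq_zero_iff.1 (by omega))
    obtain ⟨s₂, b₁, b₂, b₃⟩ := ih hls (fun k => D k - if l.1 = k then x else 0)
      (fun k => by
        have := h₁ k
        rw [e₁, e₂] at this
        by_cases hk : l.1 = k
        · subst hk; rw [if_pos rfl]; omega
        · simpa [hk] using this)
      (fun k => by
        have := h₂ k
        rw [e₂] at this
        by_cases hk : l.1 = k
        · subst hk; rw [if_pos rfl]; omega
        · simpa [hk] using this)
    refine ⟨s₁ ++ s₂, by simp [a₁, b₁, layerWord], ?_, fun k => ?_⟩
    · intro s hs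
      rcases List.mem_append.1 hs with hs | hs
      exacts [a₂ s hs, b₂ s hs]
    · rw [List.countP_append, a₃, b₃]
      by_cases hk : l.1 = k
      · subst hk; simp; omega
      · simp [hk]

lemma exists_circuit [Fintype Q] {K : Set GateType} {S : Finset Q} {ls : List (Layer Q)}
    (h : ∀ l ∈ ls, IsLayer K S l) (D : GateType → ℕ)
    (h₁ : ∀ k, layerDepth ls k ≤ D k) (h₂ : ∀ k, D k ≤ layerCost ls k) :
    ∃ c : Circuit Q, c.UsesOnly K ∧ c.ActsOn S ∧ c.operator = evalWord (layerWord ls) ∧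
      (∀ k, c.cost k = layerCost ls k) ∧ ∀ k, c.depth k = D k := by
  obtain ⟨slots, hf, hp, hD⟩ := exists_slots ls
    (fun l hl => ⟨fun g hg => ((h l hl).2.1 g hg).1, (h l hl).2.2⟩) D
    (fun k => (min_le_left _ _).trans (h₁ k)) h₂
  have hg : ∀ g ∈ slots.flatten, g.type ∈ K ∧ g.support ⊆ S := by
    intro g hg
    rw [hf] at hg
    obtain ⟨l, hl, hgl⟩ := List.mem_flatMap.1 hg
    obtain ⟨e, hS⟩ := (h l hl).2.1 g hgl
    exact ⟨e ▸ (h l hl).1, hS⟩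
  refine ⟨⟨slots, hp⟩, fun g h => (hg g h).1, fun g h => (hg g h).2, ?_, fun k => ?_, hD⟩
  · rw [Circuit.operator_eq_evalWord, Circuit.gates, hf]
  · rw [Circuit.cost, Circuit.gates, hf]
    exact countP_layerWord (fun l hl g hg => ((h l hl).2.1 g hg).1) k

/-- Every word of gates is a circuit with one gate in each time slot. -/
lemma exists_serial_circuit (w : List (Gate Q)) : ∃ c : Circuit Q, c.gates = w := by
  refine ⟨⟨w.map fun g => [g], fun s hs => ?_⟩, ?_⟩
  · obtain ⟨g, -, rfl⟩ := List.mem_map.1 hs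
    exact List.pairwise_singleton _ _
  · simp only [Circuit.gates]
    induction w with
    | nil => rfl
    | cons g w ih => simpa using ih

end Serialization
end MCX
end

noncomputable section

namespace MCX

/-! ### Ladders of relative-phase Toffoli gates -/

section Words

variable {Q : Type*} [DecidableEq Q]

/-- The CNOT gate with control `c` and target `t`; for `c = t` the value is irrelevant. -/
def cx (c t : Q) : Gate Q := if h : c = t then .H t else .cnot c t h

lemma cx_type {c t : Q} (h : c ≠ t) : (cx c t).type = .cnot := by simp [cx, h, Gate.type]

lemma cx_support (c t : Q) : (cx c t).support = {c, t} := by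
  unfold cx
  split_ifs with h <;> simp [Gate.support, h]

/-- The Hadamard gates on the targets of the rungs in `L`. -/
def hGates (L : List (Q × Q)) : List (Gate Q) := L.map fun x => .H x.2

/-- The gates `T`, CNOT, `T†` on the targets of all rungs in `L`, the CNOT gates being controlled by
the outer controls. -/
def shiftedXLayers (L : List (Q × Q)) : List (Layer Q) :=
  [(.T, L.map fun x => .T x.2), (.cnot, L.map fun x => cx x.1 x.2), (.T, L.map fun x => .Tdg x.2)]

/-- The doubly controlled `Z` gate on `e₁`, `e₂`, `d` up to a phase of `e₁` and `e₂`, or its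
inverse. -/
def bottomLayers (inv : Bool) (e₁ e₂ d : Q) : List (Layer Q) :=
  let T : Layer Q := (.T, [if inv then .Tdg d else .T d])
  let T' : Layer Q := (.T, [if inv then .T d else .Tdg d])
  [T, (.cnot, [cx e₁ d]), T', (.cnot, [cx e₂ d]), T, (.cnot, [cx e₁ d]), T', (.cnot, [cx e₂ d])]

/-- The gates that remain of a ladder when, for each rung, the first Hadamard gate and the first
three gates `T`, CNOT, `T†`, and likewise the last such gates, are left out: the part of the ladder
that has to be executed sequentially. -/
def spineLayers (inv : Bool) (e₁ e₂ : Q) : Q → List (Q × Q) → List (Layer Q)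
  | p, [] => bottomLayers inv e₁ e₂ p
  | p, (c, d) :: L =>
    (.cnot, [cx p d]) :: (shiftedXLayers [(c, d)] ++ (.H, [.H d]) :: (spineLayers inv e₁ e₂ d L ++
      (.H, [.H d]) :: (shiftedXLayers [(c, d)] ++ [(.cnot, [cx p d])])))

omit [DecidableEq Q] in
lemma layerWord_append (u w : List (Layer Q)) :
    layerWord (u ++ w) = layerWord u ++ layerWord w := by
  simp [layerWord]

omit [DecidableEq Q] in
lemma layerWord_cons (l : Layer Q) (w : List (Layer Q)) :
    layerWord (l :: w) = l.2 ++ layerWord w := rfl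

lemma wordOn_hGates (L : List (Q × Q)) : WordOn (hGates L) (L.map Prod.snd) := by
  intro g hg q hq
  obtain ⟨x, hx, rfl⟩ := List.mem_map.1 hg
  simp only [Gate.support, Finset.mem_singleton] at hq
  exact hq ▸ List.mem_map_of_mem hx

lemma wordOn_shiftedX (L : List (Q × Q)) :
    WordOn (layerWord (shiftedXLayers L)) (L.map Prod.fst ++ L.map Prod.snd) := by
  intro g hg q hq
  simp only [layerWord, shiftedXLayers, List.flatMap_cons, List.flatMap_nil, List.append_nil,
    List.mem_append, List.mem_map] at hg
  rcases hg with ⟨x, hx, rfl⟩ | ⟨x, hx, rfl⟩ | ⟨x, hx, rfl⟩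
  · simp only [Gate.support, Finset.mem_singleton] at hq
    exact List.mem_append_right _ (hq ▸ List.mem_map_of_mem hx)
  · simp only [cx_support, Finset.mem_insert, Finset.mem_singleton] at hq
    rcases hq with rfl | rfl
    · exact List.mem_append_left _ (List.mem_map_of_mem hx)
    · exact List.mem_append_right _ (List.mem_map_of_mem hx)
  · simp only [Gate.support, Finset.mem_singleton] at hq
    exact List.mem_append_right _ (hq ▸ List.mem_map_of_mem hx)

lemma wordOn_cx (c t : Q) : WordOn [cx c t] [c, t] := by
  intro g hg q hq
  rw [List.mem_singleton.1 hg, cx_support] at hq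
  simpa using hq

lemma wordOn_H (q : Q) : WordOn [.H q] [q] := by
  intro g hg q hq
  rw [List.mem_singleton.1 hg] at hq
  simpa [Gate.support] using hq

end Words

variable {Q : Type*} [Fintype Q] [DecidableEq Q]

/-- The operator of a list of layers. -/
def evalLayers (ls : List (Layer Q)) : Operator Q := evalWord (layerWord ls)

lemma evalLayers_append (u w : List (Layer Q)) :
    evalLayers (u ++ w) = evalLayers w * evalLayers u := by
  rw [evalLayers, layerWord_append, evalWord_append]; rfl

lemma evalLayers_cons (l : Layer Q) (w : List (Layer Q)) :
    evalLayers (l :: w) = evalLayers w * evalWord l.2 := by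
  rw [evalLayers, layerWord_cons, evalWord_append]; rfl

lemma evalLayers_nil : evalLayers ([] : List (Layer Q)) = 1 := rfl

lemma evalWord_nil : evalWord ([] : List (Gate Q)) = 1 := rfl

lemma evalWord_layerWord (ls : List (Layer Q)) : evalWord (layerWord ls) = evalLayers ls := rfl

lemma evalWord_cons (g : Gate Q) (w : List (Gate Q)) :
    evalWord (g :: w) = evalWord w * g.operator := rfl

lemma evalWord_singleton (g : Gate Q) : evalWord [g] = g.operator := by simp [evalWord]

lemma H_operator (q : Q) : (Gate.H q).operator = onQubit hadamard q := rfl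

lemma T_operator (q : Q) : (Gate.T q).operator = mux q fun _ => phase (Real.pi / 4) := rfl

lemma Tdg_operator (q : Q) : (Gate.Tdg q).operator = mux q fun _ => phase (-(Real.pi / 4)) := rfl

lemma cx_operator {c t : Q} (h : c ≠ t) :
    (cx c t).operator = mux t fun y => if y c = 1 then pauliX else 1 := by
  rw [cx, dif_neg h, Gate.operator, controlled_eq_mux (by simpa using h.symm)]
  simp

lemma evalLayers_shiftedX_singleton {c d : Q} (h : c ≠ d) :
    evalLayers (shiftedXLayers [(c, d)]) = mux d fun y => shiftedX (y c = 1) := by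
  simp only [shiftedXLayers, evalLayers_cons, evalLayers_nil, List.map_cons, List.map_nil,
    evalWord_singleton, cx_operator h, T_operator, Tdg_operator, one_mul, mux_mul]
  rfl

lemma isRung_relativePhase {c p d : Q} (hc : c ≠ d) (hp : p ≠ d) :
    IsRung c p d (onQubit hadamard d * evalLayers (shiftedXLayers [(c, d)]) * (cx p d).operator *
      evalLayers (shiftedXLayers [(c, d)]) * onQubit hadamard d) := by
  rw [evalLayers_shiftedX_singleton hc, cx_operator hp, onQubit_eq_mux]
  simp only [mux_mul]
  refine isRung_mux hc hp fun y v => ?_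
  have := relativePhase_conj_diagonal (y p = 1) (y c = 1) v
  simpa only [mul_assoc] using this

lemma evalLayers_bottom (inv : Bool) {e₁ e₂ d : Q} (h₁ : e₁ ≠ d) (h₂ : e₂ ≠ d) :
    evalLayers (bottomLayers inv e₁ e₂ d) =
      Matrix.diagonal (basePhase (if inv then Complex.I else -Complex.I) e₁ e₂ d) := by
  rw [diagonal_eq_mux _ d]
  cases inv
  all_goals
    simp only [bottomLayers, evalLayers_cons, evalLayers_nil, evalWord_singleton, cx_operator h₁,
      cx_operator h₂, T_operator, Tdg_operator, one_mul, mux_mul, if_true, if_false,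
      Bool.false_eq_true]
    refine mux_congr d fun y => ?_
    simp only [basePhase, Function.update_self, Function.update_of_ne h₁, Function.update_of_ne h₂]
  · have := bottom_fin_two (y e₂ = 1) (y e₁ = 1)
    simp only [and_comm] at this ⊢
    simpa only [mul_assoc] using this
  · have := bottom_inv_fin_two (y e₂ = 1) (y e₁ = 1)
    simp only [and_comm] at this ⊢
    simpa only [mul_assoc] using this

lemma evalLayers_shiftedX_cons {c d : Q} {L : List (Q × Q)}
    (h : (c :: d :: (L.map Prod.fst ++ L.map Prod.snd)).Nodup) :
    evalLayers (shiftedXLayers ((c, d) :: L)) =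
      evalLayers (shiftedXLayers L) * evalLayers (shiftedXLayers [(c, d)]) := by
  have hd : List.Disjoint [c, d] (L.map Prod.fst ++ L.map Prod.snd) := by
    simp only [List.nodup_cons, List.mem_cons, not_or] at h
    intro q hq hq'
    simp only [List.mem_cons, List.not_mem_nil, or_false] at hq
    rcases hq with rfl | rfl
    · exact h.1.2 hq'
    · exact h.2.1 hq'
  have h₁ : WordOn (L.map fun x => .T x.2 : List (Gate Q)) (L.map Prod.fst ++ L.map Prod.snd) :=
    fun g hg => wordOn_shiftedX L g (by
      simp only [layerWord, shiftedXLayers, List.flatMap_cons, List.mem_append]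
      exact Or.inl hg)
  have h₂ : WordOn (L.map fun x => cx x.1 x.2) (L.map Prod.fst ++ L.map Prod.snd) :=
    fun g hg => wordOn_shiftedX L g (by
      simp only [layerWord, shiftedXLayers, List.flatMap_cons, List.mem_append]
      exact Or.inr (Or.inl hg))
  have g₂ : WordOn [cx c d] [c, d] := wordOn_cx c d
  have g₃ : WordOn [.Tdg d] [c, d] := fun g hg q hq => by
    rw [List.mem_singleton.1 hg] at hq
    simp only [Gate.support, Finset.mem_singleton] at hq
    simp [hq]
  have c₁ := (g₂.commute h₁ hd).eq
  have c₂ := (g₃.commute h₁ hd).eq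
  have c₃ := (g₃.commute h₂ hd).eq
  have key : ∀ g : Gate Q, ∀ w, evalWord (g :: w) = evalWord w * evalWord [g] := fun g w => by
    simp [evalWord]
  simp only [shiftedXLayers, evalLayers_cons, evalLayers_nil, List.map_cons, List.map_nil, one_mul]
  rw [key (.Tdg d), key (cx c d), key (.T d)]
  generalize evalWord [cx c d] = A at *
  generalize evalWord [.Tdg d] = B at *
  generalize evalWord [.T d] = D at *
  generalize evalWord (L.map fun x => .T x.2) = X at *
  generalize evalWord (L.map fun x => cx x.1 x.2) = Y at *
  generalize evalWord (L.map fun x => .Tdg x.2) = Z at *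
  calc Z * B * (Y * A) * (X * D) = Z * (B * Y) * (A * X) * D := by simp only [mul_assoc]
    _ = Z * Y * (B * X) * (A * D) := by rw [c₁, c₃]; simp only [mul_assoc]
    _ = _ := by rw [c₂]; simp only [mul_assoc]

lemma evalWord_hGates_cons (c d : Q) (L : List (Q × Q)) :
    evalWord (hGates ((c, d) :: L)) = evalWord (hGates L) * onQubit hadamard d := rfl

section Monoid

variable {M : Type*} [Monoid M] {h P m H' P' : M}

-- `h`, `P`, `m` stand for the Hadamard gate, for the word `T`, CNOT, `T†` and for the middle CNOT
-- of the first rung, `H'` and `P'` for the Hadamard gates and the words `T`, CNOT, `T†` of the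
-- others; `h * P * m * P * h` is the whole first rung
lemma ladder_middle (c₁ : Commute P P') (c₂ : Commute m P') :
    P * m * (P' * P) = P' * P * m * P := by
  rw [← mul_assoc, ((c₁.mul_left c₂).eq)]
  simp only [mul_assoc]

lemma ladder_opening (c₁ : Commute h H') (c₂ : Commute h P') (c₃ : Commute P H')
    (c₅ : Commute m H') :
    h * (P' * P) * m * (P * (H' * h)) = P' * H' * (h * P * m * P * h) := by
  have e₁ : Commute (h * P * m * P) H' := ((c₁.mul_left c₃).mul_left c₅).mul_left c₃
  calc h * (P' * P) * m * (P * (H' * h)) = (h * P') * (P * m * P * H' * h) := by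
        simp only [mul_assoc]
    _ = P' * ((h * P * m * P) * H') * h := by rw [c₂.eq]; simp only [mul_assoc]
    _ = _ := by rw [e₁.eq]; simp only [mul_assoc]

lemma ladder_closing (c₁ : Commute h H') (c₂ : Commute h P') (c₃ : Commute P H')
    (c₄ : Commute P P') (c₅ : Commute m H') :
    H' * h * (P * m * (P' * P)) * h = (h * P * m * P * h) * (H' * P') := by
  have e₁ : Commute (h * P * m * P * h) H' :=
    (((c₁.mul_left c₃).mul_left c₅).mul_left c₃).mul_left c₁
  have e₂ : Commute (P * h) P' := c₄.mul_left c₂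
  calc H' * h * (P * m * (P' * P)) * h = H' * h * P * m * (P' * (P * h)) := by
        simp only [mul_assoc]
    _ = H' * (h * P * m * P * h) * P' := by rw [← e₂.eq]; simp only [mul_assoc]
    _ = _ := by rw [← e₁.eq]; simp only [mul_assoc]

lemma ladder_conj (K : M) (c₁ : Commute h H') (c₂ : Commute h P') (c₃ : Commute P H')
    (c₄ : Commute P P') (c₅ : Commute m H') (c₆ : Commute m P') :
    H' * h * (P' * P) * (m * P * h * K * h * P * m) * (P' * P * (H' * h)) =
      (h * P * m * P * h) * (H' * P' * K * (P' * H')) * (h * P * m * P * h) := by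
  have o := ladder_opening c₁ c₂ c₃ c₅
  have o' := ladder_closing c₁ c₂ c₃ c₄ c₅
  have o'' := ladder_middle c₄ c₆
  calc H' * h * (P' * P) * (m * P * h * K * h * P * m) * (P' * P * (H' * h))
      = H' * h * (P' * P * m * P) * h * K * (h * (P * m * (P' * P)) * (H' * h)) := by
        simp only [mul_assoc]
    _ = H' * h * (P * m * (P' * P)) * h * K * (h * (P' * P) * m * (P * (H' * h))) := by
        rw [o'']; simp only [mul_assoc]
    _ = _ := by rw [o, o']; simp only [mul_assoc]

end Monoid

/-- The gates of the first rung of a ladder commute with the Hadamard, `T` and CNOT gates of the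
other rungs `L`, except for the CNOT gates controlled by the targets of rungs. -/
lemma ladder_commute {c d p : Q} {L : List (Q × Q)}
    (h : (p :: c :: d :: (L.map Prod.fst ++ L.map Prod.snd)).Nodup) :
    Commute (onQubit hadamard d) (evalWord (hGates L)) ∧
    Commute (onQubit hadamard d) (evalLayers (shiftedXLayers L)) ∧
    Commute (evalLayers (shiftedXLayers [(c, d)])) (evalWord (hGates L)) ∧
    Commute (evalLayers (shiftedXLayers [(c, d)])) (evalLayers (shiftedXLayers L)) ∧
    Commute (cx p d).operator (evalWord (hGates L)) ∧
    Commute (cx p d).operator (evalLayers (shiftedXLayers L)) := by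
  obtain ⟨hc, hd, hp⟩ : c ∉ L.map Prod.fst ++ L.map Prod.snd ∧
      d ∉ L.map Prod.fst ++ L.map Prod.snd ∧ p ∉ L.map Prod.fst ++ L.map Prod.snd := by
    simp only [List.nodup_cons, List.mem_cons, not_or] at h
    exact ⟨h.2.1.2, h.2.2.1, h.1.2.2⟩
  have hH : ∀ {q}, q ∉ L.map Prod.fst ++ L.map Prod.snd → q ∉ L.map Prod.snd :=
    fun hq hq' => hq (List.mem_append_right _ hq')
  have hdis : ∀ {q r : Q} {l : List Q}, q ∉ l → r ∉ l → [q, r].Disjoint l := fun h₁ h₂ => by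
    simp [h₁, h₂]
  have c₁ := (wordOn_H d).commute (wordOn_hGates L) (by simpa using hH hd)
  have c₂ := (wordOn_H d).commute (wordOn_shiftedX L) (by simpa using hd)
  have c₃ := (wordOn_shiftedX [(c, d)]).commute (wordOn_hGates L) (hdis (hH hc) (hH hd))
  have c₄ := (wordOn_shiftedX [(c, d)]).commute (wordOn_shiftedX L) (hdis hc hd)
  have c₅ := (wordOn_cx p d).commute (wordOn_hGates L) (hdis (hH hp) (hH hd))
  have c₆ := (wordOn_cx p d).commute (wordOn_shiftedX L) (hdis hp hd)
  rw [evalWord_singleton] at c₁ c₂ c₅ c₆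
  exact ⟨c₁, c₂, c₃, c₄, c₅, c₆⟩

/-- Adding the initial and final Hadamard, `T` and CNOT gates of all rungs to the spine gives the
ladder, which is diagonal. -/
lemma evalLayers_ladder (inv : Bool) {e₁ e₂ p : Q} {L : List (Q × Q)}
    (h : (ladderQubits e₁ e₂ p L).Nodup) :
    evalWord (hGates L) * evalLayers (shiftedXLayers L) *
        evalLayers (spineLayers inv e₁ e₂ p L) *
        (evalLayers (shiftedXLayers L) * evalWord (hGates L)) =
      Matrix.diagonal (ladderPhase (if inv then Complex.I else -Complex.I) e₁ e₂ p L) := by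
  induction L generalizing p with
  | nil =>
    have h₁ : e₁ ≠ p := by rintro rfl; simp [ladderQubits] at h
    have h₂ : e₂ ≠ p := by rintro rfl; simp [ladderQubits] at h
    simp only [spineLayers, evalLayers_bottom inv h₁ h₂, ladderPhase]
    simp [hGates, shiftedXLayers, evalLayers, layerWord, evalWord]
  | cons x L ih =>
    obtain ⟨c, d⟩ := x
    have ih := ih (ladderQubits_cons_nodup h)
    have hn : (p :: c :: d :: (L.map Prod.fst ++ L.map Prod.snd)).Nodup := by
      simp only [ladderQubits, List.map_cons, List.nodup_cons, List.cons_append, List.mem_cons,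
        List.mem_append, List.nodup_append, not_or, ne_eq] at h ⊢
      grind
    obtain ⟨c₁, c₂, c₃, c₄, c₅, c₆⟩ := ladder_commute hn
    have hpd : p ≠ d := by rintro rfl; simp at hn
    have hcd : c ≠ d := by rintro rfl; simp at hn
    have hR := isRung_relativePhase hcd hpd (ladderPhase (if inv then Complex.I else -Complex.I)
      e₁ e₂ d L)
    rw [← ih] at hR
    have key := ladder_conj (evalLayers (spineLayers inv e₁ e₂ d L)) c₁ c₂ c₃ c₄ c₅ c₆
    simp only [ladderPhase]
    rw [← hR]
    simp only [mul_assoc] at key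
    simp only [spineLayers, evalLayers_cons, evalLayers_append, evalLayers_nil, one_mul,
      evalWord_singleton, evalLayers_shiftedX_cons hn.of_cons, evalWord_hGates_cons, H_operator,
      mul_assoc]
    exact key

end MCX
end

noncomputable section

namespace MCX

/-! ### The circuit of CNOT, `T` and Hadamard gates -/

/-- A ladder whose first rung is singled out: `c` and `d` are its outer control and target, `rest`
are the other rungs, and `e₁`, `e₂` are the controls of the gate at the bottom. -/
structure Ladder (Q : Type*) where
  /-- The first control at the bottom. -/
  e₁ : Q
  /-- The second control at the bottom. -/
  e₂ : Q
  /-- The outer control of the first rung. -/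
  c : Q
  /-- The target of the first rung. -/
  d : Q
  /-- The other rungs. -/
  rest : List (Q × Q)

section Layers

variable {Q : Type*} [DecidableEq Q]

/-- The list of all rungs of a ladder. -/
def Ladder.rungs (A : Ladder Q) : List (Q × Q) := (A.c, A.d) :: A.rest

/-- The layers of a ladder controlled by `a` between the first and the last gate on `a`. The gates
`w` are executed together with the last Hadamard gate. -/
def coreLayers (inv : Bool) (a : Q) (A : Ladder Q) (w : List (Gate Q)) : List (Layer Q) :=
  (.cnot, [cx a A.d]) :: (shiftedXLayers A.rungs ++ (.H, [.H A.d]) ::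
    (spineLayers inv A.e₁ A.e₂ A.d A.rest ++ (.H, .H A.d :: w) ::
      (shiftedXLayers A.rungs ++ [(.cnot, [cx a A.d])])))

/-- The layers between two ladders: the last gates of the first rung of `A`, the first gates of the
first rung of `B`, a Hadamard gate on `a` and the outstanding Hadamard gates of both ladders. -/
def junctionLayers (a : Q) (A B : Ladder Q) : List (Layer Q) :=
  shiftedXLayers [(A.c, A.d), (B.c, B.d)] ++
    [(.H, .H A.d :: .H a :: (hGates A.rest ++ hGates B.rest))]

/-- The layers of the commutator of the ladders `A` and `B`, the latter conjugated by a Hadamard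
gate on `a`. The whole is conjugated by a Hadamard gate on `A.d`, which cancels the first gate of
`A`. -/
def commutatorLayers (a : Q) (A B : Ladder Q) : List (Layer Q) :=
  ((.H, hGates A.rest) :: shiftedXLayers [(A.c, A.d)]) ++
    ((coreLayers false a A [.H B.d] ++ junctionLayers a A B) ++
    ((coreLayers false a B [.H A.d] ++ junctionLayers a B A) ++
    ((coreLayers true a A [.H B.d] ++ junctionLayers a A B) ++
    (coreLayers true a B [] ++ (shiftedXLayers [(B.c, B.d)] ++
      [(.H, .H B.d :: .H a :: .H A.d :: hGates B.rest)])))))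

/-- The conditions under which the gates of the ladders `A` and `B` controlled by `a` can be
executed in parallel as in `commutatorLayers`. -/
structure Compatible (a : Q) (A B : Ladder Q) : Prop where
  nodup : (a :: A.c :: B.c :: A.d :: B.d :: (A.rest.map Prod.snd ++ B.rest.map Prod.snd)).Nodup
  left : (ladderQubits A.e₁ A.e₂ a A.rungs).Nodup
  right : (ladderQubits B.e₁ B.e₂ a B.rungs).Nodup
  notMem_left : B.d ∉ A.rest.map Prod.fst
  notMem_right : A.d ∉ B.rest.map Prod.fst

omit [DecidableEq Q] in
lemma Compatible.symm {a : Q} {A B : Ladder Q} (h : Compatible a A B) : Compatible a B A := by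
  obtain ⟨h₁, h₂, h₃, h₄, h₅⟩ := h
  refine ⟨?_, h₃, h₂, h₅, h₄⟩
  simp only [List.nodup_cons, List.mem_cons,
    List.mem_append, List.nodup_append, not_or, ne_eq] at h₁ ⊢
  grind

omit [DecidableEq Q] in
lemma ladder_nodup {e₁ e₂ p c d : Q} {L : List (Q × Q)}
    (h : (ladderQubits e₁ e₂ p ((c, d) :: L)).Nodup) :
    (p :: c :: d :: (L.map Prod.fst ++ L.map Prod.snd)).Nodup := by
  simp only [ladderQubits, List.map_cons, List.nodup_cons, List.cons_append, List.mem_cons,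
    List.mem_append, List.nodup_append, not_or, ne_eq] at h ⊢
  grind

omit [DecidableEq Q] in
lemma notMem_controls {a : Q} {A : Ladder Q} (h : (ladderQubits A.e₁ A.e₂ a A.rungs).Nodup) :
    a ∉ A.e₁ :: A.e₂ :: A.rungs.map Prod.fst := by
  simp only [ladderQubits, List.nodup_cons, List.mem_cons, List.mem_append, not_or] at h ⊢
  tauto

end Layers

section Monoid

variable {M : Type*} [Monoid M] {h P m H' P' g R G' A : M}

-- `h`, `P`, `m`, `H'`, `P'` belong to the ladder that is completed, and `g`, `R`, `G'` are the
-- Hadamard gate and the word `T`, CNOT, `T†` of the first rung, and the other Hadamard gates, of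
-- the next ladder; `A` is the Hadamard gate on the ancilla
lemma block_eq (K : M) (c₁ : Commute h H') (c₂ : Commute h P') (c₃ : Commute P H')
    (c₄ : Commute P P') (c₅ : Commute m H') (d₁ : Commute g P) (d₂ : Commute g m)
    (d₃ : Commute g P') (d₄ : Commute g H') (d₅ : Commute g A) (d₆ : Commute g h)
    (d₇ : Commute R H') (d₈ : Commute R A) (d₉ : Commute R h) (d : Commute A H')
    (d' : Commute R G') :
    G' * H' * A * h * (R * P) * (m * (P' * P) * (g * h) * K * h * (P' * P) * m) *
        (P * (H' * h)) =
      R * (G' * g) * (A * ((h * P * m * P * h) * (H' * P' * K * (P' * H')) *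
        (h * P * m * P * h))) := by
  have o := ladder_opening c₁ c₂ c₃ c₅
  have o' := ladder_closing c₁ c₂ c₃ c₄ c₅
  have e₁ : Commute g (P * m * (P' * P)) := (d₁.mul_right d₂).mul_right (d₃.mul_right d₁)
  have e₂ : Commute (R * g) (H' * A * h) :=
    ((d₇.mul_right d₈).mul_right d₉).mul_left ((d₄.mul_right d₅).mul_right d₆)
  calc _ = G' * (H' * A * h * R * ((P * m * (P' * P)) * g) * h * K * (h * (P' * P) * m *
          (P * (H' * h)))) := by simp only [mul_assoc]
    _ = G' * ((H' * A * h) * (R * g) * (P * m * (P' * P)) * h * K * (h * (P' * P) * m *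
          (P * (H' * h)))) := by rw [← e₁.eq]; simp only [mul_assoc]
    _ = (G' * R) * g * ((H' * A) * (h * (P * m * (P' * P)) * h) * K * (h * (P' * P) * m *
          (P * (H' * h)))) := by rw [← e₂.eq]; simp only [mul_assoc]
    _ = R * (G' * g) * (A * (H' * h * (P * m * (P' * P)) * h) * K * (h * (P' * P) * m *
          (P * (H' * h)))) := by rw [← d'.eq, ← d.eq]; simp only [mul_assoc]
    _ = _ := by rw [o, o']; simp only [mul_assoc]

lemma last_block_eq (K : M) (c₁ : Commute h H') (c₂ : Commute h P') (c₃ : Commute P H')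
    (c₄ : Commute P P') (c₅ : Commute m H') (d : Commute A H') (d' : Commute g H') :
    H' * g * A * h * P * (m * (P' * P) * h * K * h * (P' * P) * m) * (P * (H' * h)) =
      g * (A * ((h * P * m * P * h) * (H' * P' * K * (P' * H')) * (h * P * m * P * h))) := by
  have o := ladder_opening c₁ c₂ c₃ c₅
  have o' := ladder_closing c₁ c₂ c₃ c₄ c₅
  calc _ = H' * (g * A) * (h * (P * m * (P' * P)) * h) * K * (h * (P' * P) * m *
          (P * (H' * h))) := by simp only [mul_assoc]
    _ = g * (A * (H' * h * (P * m * (P' * P)) * h) * K * (h * (P' * P) * m *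
          (P * (H' * h)))) := by rw [← (d'.mul_left d).eq]; simp only [mul_assoc]
    _ = _ := by rw [o, o']; simp only [mul_assoc]

lemma commutator_assembly {X₁ X₂ X₃ X₄ S T t V W V' W' : M} (b₁ : X₁ * S = T * (A * V))
    (b₂ : X₂ * T = S * (A * W)) (b₃ : X₃ * S = T * (A * V')) (b₄ : X₄ * T = t * (A * W')) :
    X₄ * X₃ * X₂ * X₁ * (S * t) = t * (A * W' * A * V' * (A * W * A) * V) * t := by
  calc _ = X₄ * (X₃ * (X₂ * (X₁ * S))) * t := by simp only [mul_assoc]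
    _ = X₄ * (X₃ * ((X₂ * T) * (A * V))) * t := by rw [b₁, mul_assoc X₂]
    _ = X₄ * ((X₃ * S) * (A * W) * (A * V)) * t := by rw [b₂]; simp only [mul_assoc]
    _ = (X₄ * T) * (A * V') * (A * W) * (A * V) * t := by rw [b₃]; simp only [mul_assoc]
    _ = _ := by rw [b₄]; simp only [mul_assoc]

end Monoid

variable {Q : Type*} [Fintype Q] [DecidableEq Q]

/-- The operator of a complete ladder, as the first rung times the other rungs times the first
rung. -/
lemma ladder_eq_diagonal (inv : Bool) {e₁ e₂ p c d : Q} {L : List (Q × Q)}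
    (h : (ladderQubits e₁ e₂ p ((c, d) :: L)).Nodup) :
    (onQubit hadamard d * evalLayers (shiftedXLayers [(c, d)]) * (cx p d).operator *
        evalLayers (shiftedXLayers [(c, d)]) * onQubit hadamard d) *
      (evalWord (hGates L) * evalLayers (shiftedXLayers L) *
        evalLayers (spineLayers inv e₁ e₂ d L) *
        (evalLayers (shiftedXLayers L) * evalWord (hGates L))) *
      (onQubit hadamard d * evalLayers (shiftedXLayers [(c, d)]) * (cx p d).operator *
        evalLayers (shiftedXLayers [(c, d)]) * onQubit hadamard d) =
      Matrix.diagonal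
        (ladderPhase (if inv then Complex.I else -Complex.I) e₁ e₂ p ((c, d) :: L)) := by
  have hn := ladder_nodup h
  rw [evalLayers_ladder inv (ladderQubits_cons_nodup h)]
  exact isRung_relativePhase (by rintro rfl; simp at hn) (by rintro rfl; simp at hn) _

/-- The diagonal of the operator of a ladder. -/
abbrev Ladder.phase (A : Ladder Q) (inv : Bool) (a : Q) : (Q → Fin 2) → ℂ :=
  ladderPhase (if inv then Complex.I else -Complex.I) A.e₁ A.e₂ a A.rungs

/-- If the first gates of the first rung of `A` have been executed, then the rest of `A` and a
junction complete the ladder `A`, apply the Hadamard gate to `a` and execute the first gates of the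
first rung of `B`. -/
lemma evalLayers_block (inv : Bool) {a : Q} {A B : Ladder Q} (h : Compatible a A B) :
    evalLayers (coreLayers inv a A [.H B.d] ++ junctionLayers a A B) *
        (evalLayers (shiftedXLayers [(A.c, A.d)]) * (evalWord (hGates A.rest) *
          onQubit hadamard A.d)) =
      evalLayers (shiftedXLayers [(B.c, B.d)]) * (evalWord (hGates B.rest) *
          onQubit hadamard B.d) *
        (onQubit hadamard a * Matrix.diagonal (A.phase inv a)) := by
  obtain ⟨h₁, h₂, h₃, h₄, h₅⟩ := h
  have hA := ladder_nodup h₂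
  have hB := ladder_nodup h₃
  obtain ⟨c₁, c₂, c₃, c₄, c₅, -⟩ := ladder_commute hA
  obtain ⟨-, -, d', -⟩ := ladder_commute hB
  simp only [List.nodup_cons, List.mem_cons, List.mem_append, not_or] at h₁ hA
  have d₁ := (wordOn_H B.d).commute (wordOn_shiftedX [(A.c, A.d)]) (by simp; tauto)
  have d₂ := (wordOn_H B.d).commute (wordOn_cx a A.d) (by simp; tauto)
  have d₃ := (wordOn_H B.d).commute (wordOn_shiftedX A.rest) (by simp at *; tauto)
  have d₄ := (wordOn_H B.d).commute (wordOn_hGates A.rest) (by simp at *; tauto)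
  have d₅ := (wordOn_H B.d).commute (wordOn_H a) (by simp; tauto)
  have d₆ := (wordOn_H B.d).commute (wordOn_H A.d) (by simp; tauto)
  have d₇ := (wordOn_shiftedX [(B.c, B.d)]).commute (wordOn_hGates A.rest) (by simp at *; tauto)
  have d₈ := (wordOn_shiftedX [(B.c, B.d)]).commute (wordOn_H a) (by simp; tauto)
  have d₉ := (wordOn_shiftedX [(B.c, B.d)]).commute (wordOn_H A.d) (by simp; tauto)
  have d := (wordOn_H a).commute (wordOn_hGates A.rest) (by simp at *; tauto)
  simp only [evalWord_singleton, evalWord_layerWord, H_operator] at d₁ d₂ d₃ d₄ d₅ d₆ d₇ d₈ d₉ d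
  have key := block_eq (evalLayers (spineLayers inv A.e₁ A.e₂ A.d A.rest)) c₁ c₂ c₃ c₄ c₅ d₁ d₂ d₃
    d₄ d₅ d₆ d₇ d₈ d₉ d d'
  rw [ladder_eq_diagonal inv h₂] at key
  have hn : (A.c :: A.d :: B.c :: B.d :: ([] : List Q)).Nodup := by simp at *; tauto
  have e : evalLayers (shiftedXLayers [(A.c, A.d), (B.c, B.d)]) =
      evalLayers (shiftedXLayers [(B.c, B.d)]) * evalLayers (shiftedXLayers [(A.c, A.d)]) :=
    evalLayers_shiftedX_cons (by simpa using hn)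
  have e' : evalLayers (shiftedXLayers A.rungs) =
      evalLayers (shiftedXLayers A.rest) * evalLayers (shiftedXLayers [(A.c, A.d)]) :=
    evalLayers_shiftedX_cons (ladder_nodup h₂).of_cons
  rw [← mul_assoc] at key
  refine Eq.trans ?_ key
  simp only [coreLayers, junctionLayers, evalLayers_append, evalLayers_cons, evalLayers_nil,
    one_mul, e, e', evalWord_append, evalWord_cons, evalWord_nil, H_operator, mul_assoc]

/-- The final ladder is completed as in `evalLayers_block`, but nothing is prepared after it. -/
lemma evalLayers_last_block (inv : Bool) {a : Q} {A B : Ladder Q} (h : Compatible a A B) :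
    evalLayers (coreLayers inv a B [] ++ (shiftedXLayers [(B.c, B.d)] ++
        [(.H, .H B.d :: .H a :: .H A.d :: hGates B.rest)])) *
        (evalLayers (shiftedXLayers [(B.c, B.d)]) * (evalWord (hGates B.rest) *
          onQubit hadamard B.d)) =
      onQubit hadamard A.d * (onQubit hadamard a * Matrix.diagonal (B.phase inv a)) := by
  obtain ⟨h₁, -, h₃, -, -⟩ := h
  obtain ⟨c₁, c₂, c₃, c₄, c₅, -⟩ := ladder_commute (ladder_nodup h₃)
  simp only [List.nodup_cons, List.mem_cons, List.mem_append, not_or] at h₁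
  have d := (wordOn_H a).commute (wordOn_hGates B.rest) (by simp at *; tauto)
  have d' := (wordOn_H A.d).commute (wordOn_hGates B.rest) (by simp at *; tauto)
  simp only [evalWord_singleton, H_operator] at d d'
  have key := last_block_eq (evalLayers (spineLayers inv B.e₁ B.e₂ B.d B.rest)) c₁ c₂ c₃ c₄ c₅ d d'
  rw [ladder_eq_diagonal inv h₃] at key
  have e : evalLayers (shiftedXLayers B.rungs) =
      evalLayers (shiftedXLayers B.rest) * evalLayers (shiftedXLayers [(B.c, B.d)]) :=
    evalLayers_shiftedX_cons (ladder_nodup h₃).of_cons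
  refine Eq.trans ?_ key
  simp only [coreLayers, evalLayers_append, evalLayers_cons, evalLayers_nil, one_mul, e,
    evalWord_cons, evalWord_nil, H_operator, mul_assoc]

lemma onQubit_hadamard_mul_self (q : Q) : onQubit hadamard q * onQubit hadamard q = 1 := by
  rw [onQubit_eq_mux, mux_mul, hadamard_mul_self, one_eq_mux q]

/-- The schedule applies the commutator of the two ladders. The Hadamard gate on `A.d` that is the
rightmost factor does not occur in the circuit, as it cancels the first gate of the ladder `A`. -/
lemma evalLayers_commutator {a : Q} {A B : Ladder Q} (h : Compatible a A B) :
    evalLayers (commutatorLayers a A B) =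
      onQubit hadamard A.d * (onQubit hadamard a * Matrix.diagonal (B.phase true a) *
        onQubit hadamard a * Matrix.diagonal (A.phase true a) *
        (onQubit hadamard a * Matrix.diagonal (B.phase false a) * onQubit hadamard a) *
        Matrix.diagonal (A.phase false a)) * onQubit hadamard A.d := by
  have b₁ := evalLayers_block false h
  have b₂ := evalLayers_block false h.symm
  have b₃ := evalLayers_block true h
  have b₄ := evalLayers_last_block true h
  have start : evalLayers ((.H, hGates A.rest) :: shiftedXLayers [(A.c, A.d)]) =
      evalLayers (shiftedXLayers [(A.c, A.d)]) * (evalWord (hGates A.rest) *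
          onQubit hadamard A.d) * onQubit hadamard A.d := by
    rw [mul_assoc, mul_assoc, onQubit_hadamard_mul_self, mul_one, evalLayers_cons]
  rw [commutatorLayers, evalLayers_append _ (_ ++ (_ ++ (_ ++ _))),
    evalLayers_append _ (_ ++ (_ ++ (_ ++ (_ ++ _)))), evalLayers_append _ (_ ++ (_ ++ (_ ++ _))),
    evalLayers_append (_ ++ _) (_ ++ (_ ++ _)), start]
  exact commutator_assembly b₁ b₂ b₃ b₄

end MCX
end

noncomputable section

namespace MCX

/-! ### Validity and cost of the layers -/

section Validity

variable {Q : Type*} [DecidableEq Q] {S : Finset Q}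

/-- The gate types of the circuit `commutatorLayers`. -/
abbrev cliffordT : Set GateType := {.cnot, .T, .H}

lemma isLayer_cx {c t : Q} (h : c ≠ t) (hc : c ∈ S) (ht : t ∈ S) :
    IsLayer cliffordT S (.cnot, [cx c t]) := by
  refine ⟨by simp, fun g hg => ?_, List.pairwise_singleton _ _⟩
  rw [List.mem_singleton.1 hg, cx_support]
  exact ⟨cx_type h, by simp [Finset.insert_subset_iff, hc, ht]⟩

lemma isLayer_H {L : List Q} (h : L.Nodup) (hS : ∀ q ∈ L, q ∈ S) :
    IsLayer cliffordT S (.H, L.map .H) := by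
  refine ⟨by simp, fun g hg => ?_, ?_⟩
  · obtain ⟨q, hq, rfl⟩ := List.mem_map.1 hg
    exact ⟨rfl, by simpa [Gate.support] using hS q hq⟩
  · rw [List.pairwise_map]
    exact h.imp fun hne => by simpa [Gate.support] using hne

lemma isLayer_singleton {g : Gate Q} (h : g.type ∈ cliffordT) (hS : g.support ⊆ S) :
    IsLayer cliffordT S (g.type, [g]) :=
  ⟨h, fun g' hg => by rw [List.mem_singleton.1 hg]; exact ⟨rfl, hS⟩, List.pairwise_singleton _ _⟩

lemma pairwise_disjoint_rungs {L : List (Q × Q)} (h : (L.map Prod.fst ++ L.map Prod.snd).Nodup) :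
    L.Pairwise fun x y => Disjoint ({x.1, x.2} : Finset Q) {y.1, y.2} := by
  induction L with
  | nil => exact List.Pairwise.nil
  | cons x L ih =>
    obtain ⟨c, d⟩ := x
    simp only [List.map_cons, List.cons_append, List.nodup_cons, List.mem_append, List.mem_cons,
      List.nodup_append, not_or, ne_eq] at h ih
    refine List.pairwise_cons.2 ⟨fun y hy => ?_, ih (by grind)⟩
    have h₁ : y.1 ∈ L.map Prod.fst := List.mem_map_of_mem hy
    have h₂ : y.2 ∈ L.map Prod.snd := List.mem_map_of_mem hy
    simp only [Finset.disjoint_insert_left, Finset.disjoint_singleton_left, Finset.mem_insert,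
      Finset.mem_singleton, not_or]
    grind

lemma isLayer_shiftedX {L : List (Q × Q)} (h : (L.map Prod.fst ++ L.map Prod.snd).Nodup)
    (hS : ∀ q ∈ L.map Prod.fst ++ L.map Prod.snd, q ∈ S) :
    ∀ l ∈ shiftedXLayers L, IsLayer cliffordT S l := by
  have hp := pairwise_disjoint_rungs h
  have hd : ∀ {x y : Q × Q}, Disjoint ({x.1, x.2} : Finset Q) {y.1, y.2} →
      Disjoint ({x.2} : Finset Q) {y.2} := fun h => h.mono (by simp) (by simp)
  have h₁ : ∀ x ∈ L, x.1 ∈ S := fun x hx =>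
    hS _ (List.mem_append_left _ (List.mem_map_of_mem hx))
  have h₂ : ∀ x ∈ L, x.2 ∈ S := fun x hx =>
    hS _ (List.mem_append_right _ (List.mem_map_of_mem hx))
  have hne : ∀ x ∈ L, x.1 ≠ x.2 := fun x hx hxx =>
    (List.nodup_append.1 h).2.2 _ (List.mem_map_of_mem hx) _ (List.mem_map_of_mem hx) hxx
  intro l hl
  simp only [shiftedXLayers, List.mem_cons, List.not_mem_nil, or_false] at hl
  rcases hl with rfl | rfl | rfl
  · refine ⟨by simp, fun g hg => ?_, List.pairwise_map.2 (hp.imp hd)⟩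
    obtain ⟨x, hx, rfl⟩ := List.mem_map.1 hg
    exact ⟨rfl, by simpa [Gate.support] using h₂ x hx⟩
  · refine ⟨by simp, fun g hg => ?_, List.pairwise_map.2 (by simpa only [cx_support] using hp)⟩
    obtain ⟨x, hx, rfl⟩ := List.mem_map.1 hg
    exact ⟨cx_type (hne x hx), by simp [cx_support, Finset.insert_subset_iff, h₁ x hx, h₂ x hx]⟩
  · refine ⟨by simp, fun g hg => ?_, List.pairwise_map.2 (hp.imp hd)⟩
    obtain ⟨x, hx, rfl⟩ := List.mem_map.1 hg
    exact ⟨rfl, by simpa [Gate.support] using h₂ x hx⟩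

lemma isLayer_spine (inv : Bool) {e₁ e₂ p : Q} {L : List (Q × Q)}
    (h : (ladderQubits e₁ e₂ p L).Nodup) (hS : ∀ q ∈ ladderQubits e₁ e₂ p L, q ∈ S) :
    ∀ l ∈ spineLayers inv e₁ e₂ p L, IsLayer cliffordT S l := by
  induction L generalizing p with
  | nil =>
    simp only [ladderQubits, List.map_nil, List.append_nil, List.mem_cons, List.not_mem_nil,
      or_false, forall_eq_or_imp, forall_eq, List.nodup_cons, not_or] at h hS
    have h₁ := isLayer_cx (Ne.symm h.1.1) hS.2.1 hS.1
    have h₂ := isLayer_cx (Ne.symm h.1.2) hS.2.2 hS.1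
    have h₃ : IsLayer cliffordT S (.T, [.T p]) :=
      isLayer_singleton (g := .T p) (by simp [Gate.type]) (by simpa [Gate.support] using hS.1)
    have h₄ : IsLayer cliffordT S (.T, [.Tdg p]) :=
      isLayer_singleton (g := .Tdg p) (by simp [Gate.type]) (by simpa [Gate.support] using hS.1)
    cases inv <;> simp [spineLayers, bottomLayers, h₁, h₂, h₃, h₄]
  | cons x L ih =>
    obtain ⟨c, d⟩ := x
    have hn := ladder_nodup h
    have hpd : p ≠ d := by rintro rfl; simp at hn
    have hcd : c ≠ d := by rintro rfl; simp at hn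
    have hp : p ∈ S := hS p (by simp [ladderQubits])
    have hc : c ∈ S := hS c (by simp [ladderQubits])
    have hd : d ∈ S := hS d (by simp [ladderQubits])
    have ih := ih (ladderQubits_cons_nodup h) (fun q hq => by
      simp only [ladderQubits, List.mem_cons, List.mem_append, List.map_cons,
        List.cons_append] at hq hS
      exact hS q (by tauto))
    have h₁ := isLayer_cx hpd hp hd
    have h₂ : IsLayer cliffordT S (.H, [.H d]) := isLayer_H (L := [d]) (by simp) (by simpa using hd)
    have h₃ := isLayer_shiftedX (S := S) (L := [(c, d)]) (by simpa using hcd)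
      (by simpa using ⟨hc, hd⟩)
    intro l hl
    simp only [spineLayers, List.mem_cons, List.mem_append, List.not_mem_nil, or_false] at hl
    rcases hl with rfl | hl | rfl | hl | rfl | hl | rfl
    exacts [h₁, h₃ l hl, h₂, ih l hl, h₂, h₃ l hl, h₁]

lemma isLayer_core (inv : Bool) {a : Q} {A : Ladder Q} {L : List Q}
    (h : (ladderQubits A.e₁ A.e₂ a A.rungs).Nodup)
    (hS : ∀ q ∈ ladderQubits A.e₁ A.e₂ a A.rungs, q ∈ S) (hL : (A.d :: L).Nodup)
    (hLS : ∀ q ∈ L, q ∈ S) : ∀ l ∈ coreLayers inv a A (L.map .H), IsLayer cliffordT S l := by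
  have hn := ladder_nodup h
  have had : a ≠ A.d := fun e => by simp [e] at hn
  have ha : a ∈ S := hS a (by simp [ladderQubits])
  have hd : A.d ∈ S := hS A.d (by simp [ladderQubits, Ladder.rungs])
  have hspine := isLayer_spine (S := S) inv (ladderQubits_cons_nodup h) (fun q hq => by
      simp only [ladderQubits, Ladder.rungs, List.mem_cons, List.mem_append, List.map_cons,
        List.cons_append] at hq hS
      exact hS q (by tauto))
  have h₁ := isLayer_cx had ha hd
  have h₂ : IsLayer cliffordT S (.H, [.H A.d]) :=
    isLayer_H (L := [A.d]) (by simp) (by simpa using hd)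
  have h₂' : IsLayer cliffordT S (.H, .H A.d :: L.map .H) :=
    isLayer_H hL (by simpa using ⟨hd, hLS⟩)
  have h₃ := isLayer_shiftedX (S := S) (L := A.rungs)
    (by simp only [ladderQubits, List.nodup_cons] at h; exact h.2.2.2)
    (fun q hq => hS q (by simp only [ladderQubits, List.mem_cons]; tauto))
  intro l hl
  simp only [coreLayers, List.mem_cons, List.mem_append, List.not_mem_nil, or_false] at hl
  rcases hl with rfl | hl | rfl | hl | rfl | hl | rfl
  exacts [h₁, h₃ l hl, h₂, hspine l hl, h₂', h₃ l hl, h₁]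

lemma isLayer_junction {a : Q} {A B : Ladder Q} (h : Compatible a A B)
    (hA : ∀ q ∈ ladderQubits A.e₁ A.e₂ a A.rungs, q ∈ S)
    (hB : ∀ q ∈ ladderQubits B.e₁ B.e₂ a B.rungs, q ∈ S) :
    ∀ l ∈ junctionLayers a A B, IsLayer cliffordT S l := by
  have h₁ := h.nodup
  simp only [ladderQubits, Ladder.rungs, List.map_cons, List.mem_cons, List.mem_append,
    List.cons_append] at hA hB
  have h₃ := isLayer_shiftedX (S := S) (L := [(A.c, A.d), (B.c, B.d)])
    (by simp at h₁ ⊢; tauto)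
    (by
      simp only [List.map_cons, List.map_nil, List.cons_append, List.nil_append, List.mem_cons,
        List.not_mem_nil, or_false]
      rintro q (rfl | rfl | rfl | rfl)
      exacts [hA _ (by simp), hB _ (by simp), hA _ (by simp), hB _ (by simp)])
  have h₄ := isLayer_H (S := S) (L := A.d :: a :: (A.rest.map Prod.snd ++ B.rest.map Prod.snd))
    (by
      simp only [List.nodup_cons, List.mem_cons, List.mem_append, not_or] at h₁ ⊢
      tauto)
    (by
      simp only [List.mem_cons, List.mem_append]
      rintro q (rfl | rfl | hq | hq)
      exacts [hA _ (by simp), hA _ (by simp), hA _ (by simp only [hq]; tauto),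
        hB _ (by simp only [hq]; tauto)])
  intro l hl
  simp only [junctionLayers, List.mem_append, List.mem_singleton] at hl
  rcases hl with hl | rfl
  · exact h₃ l hl
  · simpa [hGates, Function.comp_def] using h₄

lemma isLayer_commutator {a : Q} {A B : Ladder Q} (h : Compatible a A B)
    (hA : ∀ q ∈ ladderQubits A.e₁ A.e₂ a A.rungs, q ∈ S)
    (hB : ∀ q ∈ ladderQubits B.e₁ B.e₂ a B.rungs, q ∈ S) :
    ∀ l ∈ commutatorLayers a A B, IsLayer cliffordT S l := by
  have h₁ := h.nodup
  simp only [List.nodup_cons, List.mem_cons, List.mem_append, not_or] at h₁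
  have hAd : A.d ∈ S := hA A.d (by simp [ladderQubits, Ladder.rungs])
  have hBd : B.d ∈ S := hB B.d (by simp [ladderQubits, Ladder.rungs])
  have cA : ∀ inv, ∀ l ∈ coreLayers inv a A [.H B.d], IsLayer cliffordT S l := fun inv =>
    isLayer_core (L := [B.d]) inv h.left hA (by simp; tauto) (by simpa using hBd)
  have cB : ∀ inv, ∀ l ∈ coreLayers inv a B [.H A.d], IsLayer cliffordT S l := fun inv =>
    isLayer_core (L := [A.d]) inv h.right hB (by simp; tauto) (by simpa using hAd)
  have cB' : ∀ l ∈ coreLayers true a B [], IsLayer cliffordT S l :=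
    isLayer_core (L := []) true h.right hB (by simp) (by simp)
  have jAB := isLayer_junction h hA hB
  have jBA := isLayer_junction h.symm hB hA
  have single : ∀ D : Ladder Q, (ladderQubits D.e₁ D.e₂ a D.rungs).Nodup →
      (∀ q ∈ ladderQubits D.e₁ D.e₂ a D.rungs, q ∈ S) →
      ∀ l ∈ shiftedXLayers [(D.c, D.d)], IsLayer cliffordT S l := fun D hD hDS =>
    isLayer_shiftedX (by
        have := ladder_nodup hD
        simp only [List.nodup_cons, List.mem_cons, not_or] at this
        simpa using this.2.1.1)
      (by simpa using ⟨hDS _ (by simp [ladderQubits, Ladder.rungs]),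
        hDS _ (by simp [ladderQubits, Ladder.rungs])⟩)
  have hfirst : IsLayer cliffordT S (.H, hGates A.rest) := by
    have := isLayer_H (S := S) (L := A.rest.map Prod.snd) (by
        have := (List.nodup_append.1 h₁.2.2.2.2.2).1
        exact this)
      (fun q hq => hA q (by
        simp only [ladderQubits, Ladder.rungs, List.map_cons, List.mem_cons, List.mem_append]
        tauto))
    simpa [hGates, Function.comp_def] using this
  have hlast : IsLayer cliffordT S (.H, .H B.d :: .H a :: .H A.d :: hGates B.rest) := by
    have := isLayer_H (S := S) (L := B.d :: a :: A.d :: B.rest.map Prod.snd) (by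
        have := (List.nodup_append.1 h₁.2.2.2.2.2).2.1
        simp only [List.nodup_cons, List.mem_cons, not_or]
        tauto)
      (by
        simp only [List.mem_cons]
        rintro q (rfl | rfl | rfl | hq)
        exacts [hBd, hA _ (by simp [ladderQubits]), hAd, hB q (by
          simp only [ladderQubits, Ladder.rungs, List.map_cons, List.mem_cons, List.mem_append]
          tauto)])
    simpa [hGates, Function.comp_def] using this
  intro l hl
  simp only [commutatorLayers, List.mem_append, List.mem_cons, List.not_mem_nil, or_false] at hl
  rcases hl with (rfl | hl) | (hl | hl) | (hl | hl) | (hl | hl) | hl | hl | rfl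
  exacts [hfirst, single A h.left hA l hl, cA _ l hl, jAB l hl, cB _ l hl, jBA l hl, cA _ l hl,
    jAB l hl, cB' l hl, single B h.right hB l hl, hlast]

end Validity

section Counting

variable {Q : Type*}

lemma layerCost_append (u w : List (Layer Q)) (k : GateType) :
    layerCost (u ++ w) k = layerCost u k + layerCost w k := by
  simp [layerCost]

lemma layerCost_cons (l : Layer Q) (w : List (Layer Q)) (k : GateType) :
    layerCost (l :: w) k = (if l.1 = k then l.2.length else 0) + layerCost w k := by
  simp [layerCost]

lemma layerCost_nil (k : GateType) : layerCost ([] : List (Layer Q)) k = 0 := rfl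

lemma layerDepth_append (u w : List (Layer Q)) (k : GateType) :
    layerDepth (u ++ w) k = layerDepth u k + layerDepth w k := by
  simp [layerDepth]

lemma layerDepth_cons (l : Layer Q) (w : List (Layer Q)) (k : GateType) :
    layerDepth (l :: w) k = (if l.1 = k then 1 else 0) + layerDepth w k := by
  simp [layerDepth, List.count_cons, add_comm]

lemma layerDepth_nil (k : GateType) : layerDepth ([] : List (Layer Q)) k = 0 := rfl

variable [DecidableEq Q]

lemma layerCost_shiftedX (L : List (Q × Q)) (k : GateType) :
    layerCost (shiftedXLayers L) k =
      match k with
      | .cnot => L.length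
      | .T => 2 * L.length
      | .H => 0
      | .toffoli => 0 := by
  cases k
  case T => simp [shiftedXLayers, layerCost_cons, layerCost_nil]; omega
  all_goals simp [shiftedXLayers, layerCost_cons, layerCost_nil]

lemma layerCost_spine (inv : Bool) (e₁ e₂ p : Q) (L : List (Q × Q)) (k : GateType) :
    layerCost (spineLayers inv e₁ e₂ p L) k =
      match k with
      | .cnot => 4 * L.length + 4
      | .T => 4 * L.length + 4
      | .H => 2 * L.length
      | .toffoli => 0 := by
  induction L generalizing p with
  | nil => cases k <;> rfl
  | cons x L ih =>
    simp only [spineLayers, layerCost_cons, layerCost_append, layerCost_nil, layerCost_shiftedX, ih]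
    cases k <;> simp <;> omega

lemma layerCost_core (inv : Bool) (a : Q) (A : Ladder Q) (w : List (Gate Q)) (k : GateType) :
    layerCost (coreLayers inv a A w) k =
      match k with
      | .cnot => 6 * A.rest.length + 8
      | .T => 8 * A.rest.length + 8
      | .H => 2 * A.rest.length + 2 + w.length
      | .toffoli => 0 := by
  simp only [coreLayers, layerCost_cons, layerCost_append, layerCost_nil, layerCost_shiftedX,
    layerCost_spine, Ladder.rungs]
  cases k <;> simp <;> omega

lemma layerCost_junction (a : Q) (A B : Ladder Q) (k : GateType) :
    layerCost (junctionLayers a A B) k =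
      match k with
      | .cnot => 2
      | .T => 4
      | .H => A.rest.length + B.rest.length + 2
      | .toffoli => 0 := by
  simp only [junctionLayers, layerCost_cons, layerCost_append, layerCost_nil, layerCost_shiftedX]
  cases k <;> simp [hGates]

lemma layerCost_commutator (a : Q) (A B : Ladder Q) (k : GateType) :
    layerCost (commutatorLayers a A B) k =
      match k with
      | .cnot => 12 * (A.rest.length + B.rest.length) + 40
      | .T => 16 * (A.rest.length + B.rest.length) + 48
      | .H => 8 * (A.rest.length + B.rest.length) + 20
      | .toffoli => 0 := by
  simp only [commutatorLayers, layerCost_cons, layerCost_append, layerCost_nil, layerCost_shiftedX,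
    layerCost_core, layerCost_junction]
  cases k <;> simp [hGates] <;> omega

lemma layerDepth_shiftedX (L : List (Q × Q)) (k : GateType) :
    layerDepth (shiftedXLayers L) k =
      match k with
      | .cnot => 1
      | .T => 2
      | .H => 0
      | .toffoli => 0 := by
  cases k <;> simp [shiftedXLayers, layerDepth_cons, layerDepth_nil]

lemma layerDepth_spine (inv : Bool) (e₁ e₂ p : Q) (L : List (Q × Q)) (k : GateType) :
    layerDepth (spineLayers inv e₁ e₂ p L) k =
      match k with
      | .cnot => 4 * L.length + 4
      | .T => 4 * L.length + 4
      | .H => 2 * L.length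
      | .toffoli => 0 := by
  induction L generalizing p with
  | nil => cases k <;> rfl
  | cons x L ih =>
    simp only [spineLayers, layerDepth_cons, layerDepth_append, layerDepth_nil,
      layerDepth_shiftedX, ih]
    cases k <;> simp <;> omega

lemma layerDepth_core (inv : Bool) (a : Q) (A : Ladder Q) (w : List (Gate Q)) (k : GateType) :
    layerDepth (coreLayers inv a A w) k =
      match k with
      | .cnot => 4 * A.rest.length + 8
      | .T => 4 * A.rest.length + 8
      | .H => 2 * A.rest.length + 2
      | .toffoli => 0 := by
  simp only [coreLayers, layerDepth_cons, layerDepth_append, layerDepth_nil,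
    layerDepth_shiftedX, layerDepth_spine, Ladder.rungs]
  cases k <;> simp <;> omega

lemma layerDepth_junction (a : Q) (A B : Ladder Q) (k : GateType) :
    layerDepth (junctionLayers a A B) k =
      match k with
      | .cnot => 1
      | .T => 2
      | .H => 1
      | .toffoli => 0 := by
  simp only [junctionLayers, layerDepth_cons, layerDepth_append, layerDepth_nil,
    layerDepth_shiftedX]
  cases k <;> simp

lemma layerDepth_commutator (a : Q) (A B : Ladder Q) (k : GateType) :
    layerDepth (commutatorLayers a A B) k =
      match k with
      | .cnot => 8 * (A.rest.length + B.rest.length) + 37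
      | .T => 8 * (A.rest.length + B.rest.length) + 42
      | .H => 4 * (A.rest.length + B.rest.length) + 13
      | .toffoli => 0 := by
  simp only [commutatorLayers, layerDepth_cons, layerDepth_append, layerDepth_nil,
    layerDepth_shiftedX, layerDepth_core, layerDepth_junction]
  cases k <;> simp <;> omega

end Counting
end MCX
end

noncomputable section

namespace MCX

/-! ### Splitting the controls -/

section Splitting

variable {Q : Type*} [DecidableEq Q]

lemma map_snd_zip_sublist {α β : Type*} (xs : List α) (ys : List β) :
    ((xs.zip ys).map Prod.snd).Sublist ys := by
  induction xs generalizing ys with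
  | nil => simp
  | cons x xs ih =>
    cases ys with
    | nil => simp
    | cons y ys => simpa using ih ys

/-- The controls and the target can be distributed over two compatible ladders such that the first
target of one of them is `t`. -/
lemma exists_ladders {n : ℕ} (hn : 5 ≤ n) {C : Finset Q} (hC : C.card = n) {t a : Q} (ht : t ∉ C)
    (ha : a ∉ C) (hat : a ≠ t) :
    ∃ A B : Ladder Q, Compatible a A B ∧ A.d = t ∧ A.rest.length + B.rest.length + 5 = n ∧
      (∀ q ∈ ladderQubits A.e₁ A.e₂ a A.rungs, q ∈ insert t (insert a C)) ∧
      (∀ q ∈ ladderQubits B.e₁ B.e₂ a B.rungs, q ∈ insert t (insert a C)) ∧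
      ∀ y : Q → Fin 2, ((∀ q ∈ A.e₁ :: A.e₂ :: A.rungs.map Prod.fst, y q = 1) ∧
        (∀ q ∈ B.e₁ :: B.e₂ :: B.rungs.map Prod.fst, y q = 1)) ↔
          (∀ q ∈ C, y q = 1) ∧ y t = 1 := by
  have hlen : C.toList.length = n := by simpa using hC
  have hmem : ∀ q, q ∈ C ↔ q ∈ C.toList := fun q => Finset.mem_toList.symm
  have hnd : (t :: a :: C.toList).Nodup := by
    simpa [C.nodup_toList, ht, ha] using hat.symm
  generalize C.toList = l at *
  obtain ⟨x₀, x₁, x₂, y₁, y₂, zs, rfl⟩ : ∃ x₀ x₁ x₂ y₁ y₂ zs,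
      l = x₀ :: x₁ :: x₂ :: y₁ :: y₂ :: zs := by
    match l, hlen.symm ▸ hn with
    | x₀ :: x₁ :: x₂ :: y₁ :: y₂ :: zs, _ => exact ⟨x₀, x₁, x₂, y₁, y₂, zs, rfl⟩
  -- `A` has the controls `x₀`, `x₁`, `x₂`, `xs` and `B` has `t`, `y₁`, `y₂`, `ys`; the target `x₀`
  -- of the first rung of `B` must not be an outer control of `A`, nor may the control `x₂` of the
  -- first rung of `A` be a target in `B`
  obtain ⟨xs, ys, rfl, hxy, hyx⟩ : ∃ xs ys, zs = xs ++ ys ∧ xs.length ≤ ys.length + 1 ∧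
      ys.length ≤ xs.length + 1 :=
    ⟨zs.take (zs.length / 2), zs.drop (zs.length / 2), by simp, by simp; omega, by simp; omega⟩
  have fx : (xs.zip (y₁ :: ys)).map Prod.fst = xs := List.map_fst_zip (by simpa using hxy)
  have fy : (ys.zip (x₁ :: xs)).map Prod.fst = ys := List.map_fst_zip (by simpa using hyx)
  have sx : ((xs.zip (y₁ :: ys)).map Prod.snd).Sublist (y₁ :: ys) :=
    map_snd_zip_sublist _ _
  have sy : ((ys.zip (x₁ :: xs)).map Prod.snd).Sublist (x₁ :: xs) :=
    map_snd_zip_sublist _ _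
  have lx : (xs.zip (y₁ :: ys)).length = xs.length := by simpa using hxy
  have ly : (ys.zip (x₁ :: xs)).length = ys.length := by simpa using hyx
  generalize xs.zip (y₁ :: ys) = L at *
  generalize ys.zip (x₁ :: xs) = L' at *
  have mx := sx.subset
  have my := sy.subset
  have nx : (y₁ :: ys).Nodup → (L.map Prod.snd).Nodup := fun h => h.sublist sx
  have ny : (x₁ :: xs).Nodup → (L'.map Prod.snd).Nodup := fun h => h.sublist sy
  simp only [List.subset_def, List.mem_cons] at mx my
  simp only [List.nodup_cons, List.mem_cons, List.mem_append, List.nodup_append, not_or,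
    ne_eq] at hnd nx ny
  refine ⟨⟨x₀, x₁, x₂, t, L⟩, ⟨t, y₁, y₂, x₀, L'⟩, ⟨?_, ?_, ?_, ?_, ?_⟩, rfl, ?_, ?_, ?_, ?_⟩
  · simp only [List.nodup_cons, List.mem_cons, List.mem_append, List.nodup_append, not_or, ne_eq]
    grind
  · simp only [ladderQubits, Ladder.rungs, List.map_cons, fx, List.nodup_cons, List.mem_cons,
      List.cons_append, List.mem_append, List.nodup_append, not_or, ne_eq]
    grind
  · simp only [ladderQubits, Ladder.rungs, List.map_cons, fy, List.nodup_cons, List.mem_cons,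
      List.cons_append, List.mem_append, List.nodup_append, not_or, ne_eq]
    grind
  · simp only [fx]; grind
  · simp only [fy]; grind
  · simp at hlen; simp only [lx, ly]; omega
  · simp only [ladderQubits, Ladder.rungs, List.map_cons, fx, List.mem_cons, List.cons_append,
      List.mem_append, Finset.mem_insert, hmem]
    grind
  · simp only [ladderQubits, Ladder.rungs, List.map_cons, fy, List.mem_cons, List.cons_append,
      List.mem_append, Finset.mem_insert, hmem]
    grind
  · intro y
    simp only [Ladder.rungs, List.map_cons, fx, fy, hmem, List.forall_mem_cons,
      List.forall_mem_append]
    tauto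

end Splitting

/-! ### The circuit of Toffoli and Hadamard gates -/

section Words

variable {Q : Type*} [DecidableEq Q]

/-- The Toffoli gate with controls `c`, `p` and target `d`; if these qubits are not distinct, the
value is irrelevant. -/
def ccx (c p d : Q) : Gate Q :=
  if h : c ≠ p ∧ c ≠ d ∧ p ≠ d then .toffoli c p d h.1 h.2.1 h.2.2 else .H d

lemma ccx_type {c p d : Q} (h₁ : c ≠ p) (h₂ : c ≠ d) (h₃ : p ≠ d) :
    (ccx c p d).type = .toffoli := by
  rw [ccx, dif_pos ⟨h₁, h₂, h₃⟩]; rfl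

lemma ccx_support (c p d : Q) : (ccx c p d).support ⊆ {c, p, d} := by
  unfold ccx
  split_ifs with h <;> simp [Gate.support]

/-- The ladder of Toffoli gates with a doubly controlled `Z` gate at the bottom. -/
def toffoliLadder (e₁ e₂ : Q) : Q → List (Q × Q) → List (Gate Q)
  | p, [] => [.H p, ccx e₁ e₂ p, .H p]
  | p, (c, d) :: L => ccx c p d :: (toffoliLadder e₁ e₂ d L ++ [ccx c p d])

/-- The commutator of two ladders of Toffoli gates, one of them conjugated by a Hadamard gate on
`a`, and the whole conjugated by a Hadamard gate on `t`. -/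
def toffoliWord (t a : Q) (A B : Ladder Q) : List (Gate Q) :=
  let V := toffoliLadder A.e₁ A.e₂ a A.rungs
  let W := toffoliLadder B.e₁ B.e₂ a B.rungs
  .H t :: (V ++ .H a :: (W ++ .H a :: (V ++ .H a :: (W ++ [.H a, .H t]))))

omit [DecidableEq Q] in
lemma ladder_ne {e₁ e₂ p c d : Q} {L : List (Q × Q)}
    (h : (ladderQubits e₁ e₂ p ((c, d) :: L)).Nodup) : c ≠ p ∧ c ≠ d ∧ p ≠ d := by
  have := ladder_nodup h
  simp only [List.nodup_cons, List.mem_cons, not_or] at this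
  exact ⟨Ne.symm this.1.1, this.2.1.1, this.1.2.1⟩

/-- The gates of a ladder are Toffoli and Hadamard gates on its qubits, and two Toffoli gates per
rung and one at the bottom. -/
lemma toffoliLadder_spec {e₁ e₂ p : Q} {L : List (Q × Q)} {S : Finset Q}
    (h : (ladderQubits e₁ e₂ p L).Nodup) (hS : ∀ q ∈ ladderQubits e₁ e₂ p L, q ∈ S) :
    (∀ g ∈ toffoliLadder e₁ e₂ p L, (g.type = .toffoli ∨ g.type = .H) ∧ g.support ⊆ S) ∧
      (toffoliLadder e₁ e₂ p L).countP (fun g => g.type = .toffoli) = 2 * L.length + 1 := by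
  induction L generalizing p with
  | nil =>
    simp only [ladderQubits, List.map_nil, List.append_nil, List.mem_cons, List.not_mem_nil,
      or_false, forall_eq_or_imp, forall_eq, List.nodup_cons, not_or] at h hS
    have ht := ccx_type h.2.1 (Ne.symm h.1.1) (Ne.symm h.1.2)
    have hs : (ccx e₁ e₂ p).support ⊆ S := (ccx_support _ _ _).trans (by
      simp [Finset.insert_subset_iff, hS])
    have hH : ∀ q : Q, (Gate.H q).type = .H ∧ (Gate.H q).support = {q} := fun q => ⟨rfl, rfl⟩
    simp [toffoliLadder, ht, hs, hH, hS]
  | cons x L ih =>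
    obtain ⟨c, d⟩ := x
    obtain ⟨h₁, h₂, h₃⟩ := ladder_ne h
    have hs : (ccx c p d).support ⊆ S := (ccx_support _ _ _).trans (by
      rw [Finset.insert_subset_iff, Finset.insert_subset_iff, Finset.singleton_subset_iff]
      exact ⟨hS _ (by simp [ladderQubits]), hS _ (by simp [ladderQubits]),
        hS _ (by simp [ladderQubits])⟩)
    obtain ⟨ih₁, ih₂⟩ := ih (ladderQubits_cons_nodup h) (fun q hq => by
      simp only [ladderQubits, List.mem_cons, List.mem_append, List.map_cons,
        List.cons_append] at hq hS
      exact hS q (by tauto))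
    have ht := ccx_type h₁ h₂ h₃
    refine ⟨fun g hg => ?_, ?_⟩
    · simp only [toffoliLadder, List.mem_cons, List.mem_append, List.not_mem_nil, or_false] at hg
      rcases hg with rfl | hg | rfl
      exacts [⟨Or.inl ht, hs⟩, ih₁ g hg, ⟨Or.inl ht, hs⟩]
    · simp only [toffoliLadder, List.countP_cons, List.countP_append, ih₂, ht]
      simp
      omega

end Words

variable {Q : Type*} [Fintype Q] [DecidableEq Q]

lemma ccx_operator {c p d : Q} (h₁ : c ≠ p) (h₂ : c ≠ d) (h₃ : p ≠ d) :
    (ccx c p d).operator = mux d fun y => if y p = 1 ∧ y c = 1 then pauliX else 1 := by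
  rw [ccx, dif_pos ⟨h₁, h₂, h₃⟩, Gate.operator,
    controlled_eq_mux (by simpa using ⟨h₂.symm, h₃.symm⟩)]
  simp [and_comm]

lemma evalWord_toffoliLadder {e₁ e₂ p : Q} {L : List (Q × Q)}
    (h : (ladderQubits e₁ e₂ p L).Nodup) :
    evalWord (toffoliLadder e₁ e₂ p L) = Matrix.diagonal (ladderPhase 1 e₁ e₂ p L) := by
  induction L generalizing p with
  | nil =>
    simp only [ladderQubits, List.map_nil, List.append_nil, List.mem_cons, List.not_mem_nil,
      or_false, List.nodup_cons, not_or] at h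
    rw [diagonal_eq_mux _ p]
    simp only [toffoliLadder, evalWord_cons, evalWord_nil, H_operator, onQubit_eq_mux,
      ccx_operator h.2.1 (Ne.symm h.1.1) (Ne.symm h.1.2), one_mul, mux_mul]
    refine mux_congr p fun y => ?_
    simp only [ladderPhase, basePhase, Function.update_of_ne (Ne.symm h.1.1),
      Function.update_of_ne (Ne.symm h.1.2), Function.update_self]
    by_cases h₁ : y e₁ = 1 <;> by_cases h₂ : y e₂ = 1 <;>
      simp [h₁, h₂, diagonal_fin_two, hadamard_conj, pauliX, Matrix.one_fin_two]
    norm_num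
  | cons x L ih =>
    obtain ⟨c, d⟩ := x
    obtain ⟨h₁, h₂, h₃⟩ := ladder_ne h
    have hR : IsRung c p d (ccx c p d).operator := by
      rw [ccx_operator h₁ h₂ h₃]
      exact isRung_mux h₂ h₃ fun y v => toffoli_conj_diagonal (y p = 1) (y c = 1) v
    rw [toffoliLadder, evalWord_cons, evalWord_append, ih (ladderQubits_cons_nodup h),
      evalWord_singleton]
    exact hR _

/-- The commutator of two ladders, conjugated by a Hadamard gate on `t`, is the multi-controlled
`X` gate; `ζ` and `ξ` are the relative phases of the ladders and of their inverses. -/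
lemma commutator_eq_controlled {C : Finset Q} {t a : Q} (ht : t ∉ C) {A B : Ladder Q}
    (h : Compatible a A B) {ζ ξ : ℂ} (hζ : ζ * ξ = 1)
    (hy : ∀ y : Q → Fin 2, ((∀ q ∈ A.e₁ :: A.e₂ :: A.rungs.map Prod.fst, y q = 1) ∧
        (∀ q ∈ B.e₁ :: B.e₂ :: B.rungs.map Prod.fst, y q = 1)) ↔
          (∀ q ∈ C, y q = 1) ∧ y t = 1) :
    onQubit hadamard t * (onQubit hadamard a *
        Matrix.diagonal (ladderPhase ξ B.e₁ B.e₂ a B.rungs) * onQubit hadamard a *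
        Matrix.diagonal (ladderPhase ξ A.e₁ A.e₂ a A.rungs) *
        (onQubit hadamard a * Matrix.diagonal (ladderPhase ζ B.e₁ B.e₂ a B.rungs) *
          onQubit hadamard a) *
        Matrix.diagonal (ladderPhase ζ A.e₁ A.e₂ a A.rungs)) * onQubit hadamard t =
      controlled C t pauliX := by
  rw [commutator_eq_diagonal (notMem_controls h.left) (notMem_controls h.right)
    (ladderPhase_mul_eq_one hζ _ _ _ _) (ladderPhase_mul_eq_one hζ _ _ _ _)
    (fun y => by convert ladderPhase_flip h.left y)
    (fun y => by convert ladderPhase_flip h.right y)]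
  exact controlled_pauliX_eq ht hy

lemma evalWord_toffoliWord (t : Q) {a : Q} {A B : Ladder Q} (h : Compatible a A B) :
    evalWord (toffoliWord t a A B) =
      onQubit hadamard t * (onQubit hadamard a *
        Matrix.diagonal (ladderPhase 1 B.e₁ B.e₂ a B.rungs) * onQubit hadamard a *
        Matrix.diagonal (ladderPhase 1 A.e₁ A.e₂ a A.rungs) *
        (onQubit hadamard a * Matrix.diagonal (ladderPhase 1 B.e₁ B.e₂ a B.rungs) *
          onQubit hadamard a) *
        Matrix.diagonal (ladderPhase 1 A.e₁ A.e₂ a A.rungs)) * onQubit hadamard t := by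
  simp only [toffoliWord, evalWord_cons, evalWord_append, evalWord_nil, H_operator, one_mul,
    evalWord_toffoliLadder h.left, evalWord_toffoliLadder h.right, mul_assoc]

end MCX
end

theorem mainTheorem2 {Q : Type*} [Fintype Q] [DecidableEq Q] (n : ℕ) (hn : 5 ≤ n)
    (C : Finset Q) (hC : C.card = n) (t a : Q) (ht : t ∉ C) (ha : a ∉ C) (hat : a ≠ t) :
    (∃ c : MCX.Circuit Q,
      c.UsesOnly {.cnot, .T, .H} ∧
      c.ActsOn (insert t (insert a C)) ∧
      c.operator = MCX.controlled C t MCX.pauliX ∧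
      c.cost .cnot = 12 * (n + 1) - 32 ∧
      c.depth .cnot = 8 * (n + 1) - 8 ∧
      c.cost .T = 16 * (n + 1) - 48 ∧
      c.depth .T = (if Odd (n + 1) then 8 * (n + 1) - 3 else 8 * (n + 1) - 6) ∧
      c.cost .H = 8 * (n + 1) - 32 + 4 ∧
      c.depth .H = 4 * (n + 1) - 11) ∧
    (∃ c : MCX.Circuit Q,
      c.UsesOnly {.toffoli, .H} ∧
      c.ActsOn (insert t (insert a C)) ∧
      c.operator = MCX.controlled C t MCX.pauliX ∧
      c.cost .toffoli = 4 * n - 8) := by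
  obtain ⟨A, B, hAB, hAt, hlen, hA, hB, hy⟩ := MCX.exists_ladders hn hC ht ha hat
  constructor
  · let D : MCX.GateType → ℕ := fun k =>
      match k with
      | .cnot => 8 * (n + 1) - 8
      | .T => if Odd (n + 1) then 8 * (n + 1) - 3 else 8 * (n + 1) - 6
      | .H => 4 * (n + 1) - 11
      | .toffoli => 0
    obtain ⟨c, hK, hS, hop, hcost, hdepth⟩ := MCX.exists_circuit
      (MCX.isLayer_commutator hAB hA hB) D
      (fun k => by
        rw [MCX.layerDepth_commutator]
        cases k <;> simp only [D] <;> first | omega | (split_ifs <;> omega))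
      (fun k => by
        rw [MCX.layerCost_commutator]
        cases k <;> simp only [D] <;> first | omega | (split_ifs <;> omega))
    refine ⟨c, hK, hS, ?_, ?_, hdepth .cnot, ?_, hdepth .T, ?_, hdepth .H⟩
    · have key := MCX.evalLayers_commutator hAB
      rw [hAt] at key
      rw [hop]
      refine key.trans (MCX.commutator_eq_controlled ht hAB ?_ hy)
      simp
    all_goals
      rw [hcost, MCX.layerCost_commutator]
      simp only
      omega
  · obtain ⟨c, hc⟩ := MCX.exists_serial_circuit (MCX.toffoliWord t a A B)
    obtain ⟨a₁, a₂⟩ := MCX.toffoliLadder_spec hAB.left hA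
    obtain ⟨b₁, b₂⟩ := MCX.toffoliLadder_spec hAB.right hB
    have hH : ∀ q ∈ insert t (insert a C), ((MCX.Gate.H q).type = .toffoli ∨
        (MCX.Gate.H q).type = .H) ∧ (MCX.Gate.H q).support ⊆ insert t (insert a C) := fun q hq =>
      ⟨Or.inr rfl, by simpa only [MCX.Gate.support, Finset.singleton_subset_iff] using hq⟩
    have hg : ∀ g ∈ MCX.toffoliWord t a A B,
        (g.type = .toffoli ∨ g.type = .H) ∧ g.support ⊆ insert t (insert a C) := by
      intro g hg
      simp only [MCX.toffoliWord, List.mem_cons, List.mem_append, List.not_mem_nil, or_false] at hg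
      rcases hg with rfl | hg | rfl | hg | rfl | hg | rfl | hg | rfl | rfl
      exacts [hH _ (by simp), a₁ g hg, hH _ (by simp), b₁ g hg, hH _ (by simp), a₁ g hg,
        hH _ (by simp), b₁ g hg, hH _ (by simp), hH _ (by simp)]
    refine ⟨c, fun g h => (hg g (hc ▸ h)).1, fun g h => (hg g (hc ▸ h)).2, ?_, ?_⟩
    · rw [MCX.Circuit.operator_eq_evalWord, hc, MCX.evalWord_toffoliWord t hAB]
      exact MCX.commutator_eq_controlled ht hAB (one_mul 1) hy
    · have hT : ∀ q : Q, (MCX.Gate.H q).type = .H := fun _ => rfl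
      rw [MCX.Circuit.cost, hc]
      simp only [MCX.toffoliWord, List.countP_cons, List.countP_append, List.countP_nil, a₂, b₂, hT]
      simp only [MCX.Ladder.rungs, List.length_cons]
      simp
      omega
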